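/- For an integer $n\ge 2$ put $D=2n-3$. For pairwise distinct complex numbers $w_0,\dots,w_n$ the sum $$v_n=\sum_{0\le i<j\le n}\frac{\prod_{a=0}^{D}\bigl(a\,w_i+(D-a)\,w_j\bigr)}{\prod_{0\le k\le n,\ k\ne i,j}(w_i-w_k)(w_j-w_k)}$$ is a positive integer that does not depend on $w_0,\dots,w_n$ (it is the number of lines on a generic hypersurface of degree $2n-3$ in $\mathbb P^n$). As $n\to\infty$ there are asymptotic expansions to all orders in powers of $n^{-1}$, $$\frac{v_n}{\sqrt{27/\pi}\,(2n-3)^{2n-7/2}}\sim\sum_{k\ge0}\frac{c_k}{n^k}=1-\frac{9}{8n}-\frac{111}{640n^2}-\frac{9999}{25600n^3}+\frac{87261}{5734400n^4}+\cdots$$ and $$\log\frac{v_n}{(2n)!}-\bigl(2n-4\log n+C\bigr)\sim\sum_{k\ge1}\frac{e_k}{n^k}=\frac{11}{6n}+\frac{141}{160n^2}+\frac{9973}{28800n^3}+\frac{59673}{179200n^4}+\cdots,$$ with $C=-3-\log\pi-\frac32\log\frac83$; that is, for every $K\ge0$ the difference between the left-hand side and the sum of the terms with $k<K$ is $O(n^{-K})$.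 The coefficients $c_k$, $e_k$ are rational and explicitly computable as follows. Let $B_i$ be the Bernoulli numbers ($B_2=\frac16$), let $$A(y,\varepsilon)=\sum_{k\ge1}\Bigl(\frac{(-1)^{k+1}}{2k+3}y^{k+1}+\sum_{\substack{i+j=k+1\\2\le i\le 2j}}\frac{(-1)^{j-1}2^{i-1}}{j(2j+1)}\binom{2j+1}{i}B_i\,y^j\Bigr)\varepsilon^k\in\mathbb Q[y][[\varepsilon]],$$ let $L:\mathbb Q[y]\to\mathbb Q$ be the linear map with $L(y^m)=\frac23\,\frac{(2m)!}{m!}\bigl(\frac34\bigr)^m$, applied coefficientwise to power series in $\varepsilon$, and define $d_k\in\mathbb Q$ by $\sum_k d_k\varepsilon^k=L\bigl(y\,(1+\varepsilon y)^{-2}e^{A(y,\varepsilon)}\bigr)$. Then, as formal power series in $x$, $$\sum_{k\ge0}c_kx^k=\sum_{j\ge0}d_j\Bigl(\frac{x}{2-3x}\Bigr)^j,$$ $$\sum_{k\ge1}e_kx^k=\log\Bigl(\sum_{k\ge0}c_kx^k\Bigr)-\sum_{k\ge1}\Bigl(\frac{2}{k+1}\bigl(\tfrac32\bigr)^{k+1}-\frac{7}{2k}\bigl(\tfrac32\bigr)^{k}+\frac{B_{k+1}}{k(k+1)2^k}\Bigr)x^k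 .$$ -/

import Mathlib

open Filter Asymptotics Topology
open scoped Nat Polynomial

noncomputable section

namespace LinesInHypersurfaces

/-- For `D = 2 * n - 3` (used only for `2 ≤ n`) and pairwise distinct `w 0, …, w n`, the sum
`∑_{0 ≤ i < j ≤ n} ∏_{a = 0}^{D} (a w_i + (D - a) w_j) / ∏_{k ≠ i, j} (w_i - w_k) (w_j - w_k)`. -/
def localizationSum (n : ℕ) (w : Fin (n + 1) → ℂ) : ℂ :=
  ∑ i : Fin (n + 1), ∑ j ∈ Finset.univ.filter (fun j => i < j),
    (∏ a ∈ Finset.range (2 * n - 3 + 1), ((a : ℂ) * w i + (2 * (n : ℂ) - 3 - (a : ℂ)) * w j)) /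
      ∏ k ∈ Finset.univ.filter (fun k => k ≠ i ∧ k ≠ j), ((w i - w k) * (w j - w k))

/-- `f n ∼ ∑_{k ≥ 0} c k / n ^ k` as an asymptotic expansion for `n → ∞`: for every `K`, the error
after the terms with `k < K` is `O(n ^ (-K))`. -/
def HasAsymptoticExpansion (f : ℕ → ℝ) (c : ℕ → ℚ) : Prop :=
  ∀ K : ℕ, (fun n : ℕ => f n - ∑ k ∈ Finset.range K, (c k : ℝ) / (n : ℝ) ^ k)
    =O[atTop] (fun n : ℕ => 1 / (n : ℝ) ^ K)

/-- The formal power series in `ε` over `ℚ[y]` (here `y` is `Polynomial.X`), without constant term,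
in which the coefficient of `ε ^ k` for `k ≥ 1` is
`(-1)^(k+1) / (2k+3) y^(k+1)
  + ∑_{i + j = k + 1, 2 ≤ i ≤ 2j} (-1)^(j-1) / (j (2j+1)) binom(2j+1, i) B_i 2^(i-1) y^j`,
where the `B_i` are the Bernoulli numbers. -/
def exponentSeries : PowerSeries ℚ[X] :=
  PowerSeries.mk fun k =>
    if k = 0 then 0 else
      Polynomial.monomial (k + 1) ((-1 : ℚ) ^ (k + 1) / (2 * (k : ℚ) + 3)) +
        ∑ p ∈ (Finset.HasAntidiagonal.antidiagonal (k + 1)).filter (fun p => 2 ≤ p.1 ∧ p.1 ≤ 2 * p.2),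
          Polynomial.monomial p.2
            ((-1 : ℚ) ^ (p.2 - 1) / ((p.2 : ℚ) * (2 * (p.2 : ℚ) + 1)) *
              (Nat.choose (2 * p.2 + 1) p.1 : ℚ) * bernoulli p.1 * (2 : ℚ) ^ (p.1 - 1))

/-- The coefficient of `ε ^ k` in the exponential of `exponentSeries`; the powers with exponent
`m > k` do not contribute since `exponentSeries` has no constant term. -/
def expCoeff (k : ℕ) : ℚ[X] :=
  ∑ m ∈ Finset.range (k + 1),
    ((1 : ℚ) / (m ! : ℚ)) • PowerSeries.coeff k (exponentSeries ^ m)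

/-- The `ℚ`-linear functional on `ℚ[y]` with `y ^ m ↦ (2/3) (2m)! / m! (3/4)^m`. -/
def momentFunctional (p : ℚ[X]) : ℚ :=
  p.sum fun m a => a * ((2 / 3 : ℚ) * (((2 * m)! : ℚ) / (m ! : ℚ)) * (3 / 4 : ℚ) ^ m)

/-- The moment functional applied to the coefficient of `ε ^ k` in
`y (1 + ε y)^(-2) exp (exponentSeries)`. These are the coefficients of the expansion in powers of
`1 / (2 n - 3)`. -/
def degreeCoeff (k : ℕ) : ℚ :=
  momentFunctional
    (∑ p ∈ Finset.HasAntidiagonal.antidiagonal k,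
      Polynomial.monomial (p.1 + 1) ((-1 : ℚ) ^ p.1 * ((p.1 : ℚ) + 1)) * expCoeff p.2)

/-- The coefficient of `x ^ k` in `∑_j degreeCoeff j * (x / (2 - 3 x)) ^ j`, where `x` stands for
`1 / n`, so that `x / (2 - 3 x)` stands for `1 / (2 n - 3)`. For `1 ≤ j ≤ k` the coefficient of
`x ^ k` in `(x / (2 - 3 x)) ^ j` is `2 ^ (-j) * binom(k - 1, k - j) * (3 / 2) ^ (k - j)`. -/
def coeffC (k : ℕ) : ℚ :=
  if k = 0 then degreeCoeff 0 else
    ∑ j ∈ Finset.Icc 1 k,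
      degreeCoeff j / 2 ^ j * (Nat.choose (k - 1) (k - j) : ℚ) * (3 / 2 : ℚ) ^ (k - j)

/-- The coefficient of `x ^ k` in `log (∑_j coeffC j * x ^ j)` (recall `coeffC 0 = 1`). -/
def logCoeff (k : ℕ) : ℚ :=
  ∑ m ∈ Finset.Icc 1 k,
    (-1 : ℚ) ^ (m - 1) / (m : ℚ) *
      PowerSeries.coeff k ((PowerSeries.mk fun j => if j = 0 then 0 else coeffC j) ^ m)

/-- The coefficients (with `coeffE 0 = 0`) of the expansion of
`log (v n / (2 n)!) - (2 n - 4 log n + C)`. -/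
def coeffE (k : ℕ) : ℚ :=
  if k = 0 then 0 else
    logCoeff k - 2 * (3 / 2 : ℚ) ^ (k + 1) / ((k : ℚ) + 1) + 7 / 2 * (3 / 2 : ℚ) ^ k / (k : ℚ)
      - bernoulli (k + 1) / ((k : ℚ) * ((k : ℚ) + 1) * 2 ^ k)

end LinesInHypersurfaces

end

/-!
The localization sum is evaluated by divided differences. With `d i = ∏_{k ≠ i} (w i - w k)` it is
`-1/2 ∑_{i, j} G(w i, w j) / (d i d j)`, where `G(x, y) = (x - y)² ∏_a (a x + (D - a) y)` is a form
of degree `2 n`. As `∑_i (w i)^m / d i` is `0` for `m < n` and `1` for `m = n`, only the coefficient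
of `x^n y^n` in `G` survives (`sum_homEval_div`), and the palindromic symmetry of the product shows
that it is `-2` times an integer, `lineCount n` (`localizationSum_eq`).

Put `N = n - 1`, so that `D = 2 N - 1`. Extracting the same coefficient by integration over
`x = exp (i θ)`, `y = exp (-i θ)` gives
`lineCount n = 4/π ∫_0^{π/2} sin² θ ∏_{l < N} (D² cos² θ + (2 l + 1)² sin² θ) dθ`
(`lineCount_eq_integral`), in which the integrand is positive.

The integral is treated by Laplace's method. The substitution `tan θ = s / √D`, with `y = s²` and
`ε = 1 / D`, turns the integrand into `s² exp (-y/3)` times `(1 + ε y)⁻² exp A`. By the Taylor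
expansion of the logarithm and Faulhaber's formula for sums of powers of odd numbers, `A` has the
expansion `exponentSeries`, uniformly for `y ≤ √D`, where `A` is moreover bounded
(`hasExp_logRatio`, `abs_logRatio_le`). The part of the integral with `y > √D` is exponentially
small in `√D`, and the Gaussian moments are the values of `momentFunctional`
(`exists_abs_lineCount_sub_le`).

All expansions are handled by one calculus. A `Scale` is a small parameter with a weight in which
errors may grow polynomially, and `Scale.HasExp f F` says that `f` has the formal power series `F`
as its expansion. This relation is compatible with sums, products and, by `Scale.HasExp.comp`, with
substitution, which covers the exponential and the logarithm, and the passage from powers of `1 / D`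
to powers of `1 / n`.

The logarithmic expansion needs the Stirling series to all orders. The differences of consecutive
remainders in Stirling's formula and of consecutive values of the series have the same expansion, by
the value of the Bernoulli polynomials at `-1` (`stirlingCoeff_sub_sum`); summing the differences
bounds the error (`hasExp_stirlingRemainder`).
-/

noncomputable section

namespace LinesInHypersurfaces

open Polynomial hiding bernoulli
open Finset

/-! ### The localization sum as a coefficient -/

/-- The value at `(x, y)` of the homogenization of degree `N` of the polynomial `q`; the
coefficients of `q` beyond `N` are discarded. -/
def homEval {R : Type*} [CommRing R] (N : ℕ) (q : R[X]) (x y : R) : R :=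
  ∑ p ∈ antidiagonal N, q.coeff p.1 * x ^ p.1 * y ^ p.2

lemma homEval_linear_mul {R : Type*} [CommRing R] {N : ℕ} {q : R[X]} (hq : q.natDegree ≤ N)
    (a b x y : R) :
    homEval (N + 1) ((C a * X + C b) * q) x y = (a * x + b * y) * homEval N q x y := by
  have h1 : homEval (N + 1) (C a * (X * q)) x y = a * x * homEval N q x y := by
    rw [homEval, homEval, Nat.sum_antidiagonal_succ, mul_sum]
    simp only [coeff_C_mul, coeff_X_mul, mul_coeff_zero, coeff_X_zero]
    rw [zero_mul, mul_zero, zero_mul, zero_mul, zero_add]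
    exact sum_congr rfl fun p _ => by ring
  have h2 : homEval (N + 1) (C b * q) x y = b * y * homEval N q x y := by
    rw [homEval, homEval, Nat.sum_antidiagonal_succ', mul_sum]
    have : q.coeff (N + 1) = 0 := coeff_eq_zero_of_natDegree_lt (by omega)
    simp only [coeff_C_mul, this]
    rw [mul_zero, zero_mul, zero_mul, zero_add]
    exact sum_congr rfl fun p _ => by ring
  have h3 : (C a * X + C b) * q = C a * (X * q) + C b * q := by ring
  rw [h3, add_mul, ← h1, ← h2]
  simp only [homEval, coeff_add, ← sum_add_distrib]
  exact sum_congr rfl fun p _ => by ring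

lemma homEval_sq_mul {R : Type*} [CommRing R] {N : ℕ} {q : R[X]} (hq : q.natDegree ≤ N)
    (x y : R) :
    homEval (N + 2) ((X - 1) ^ 2 * q) x y = (x - y) ^ 2 * homEval N q x y := by
  have e : (X - 1) ^ 2 * q = (C 1 * X + C (-1)) * ((C 1 * X + C (-1)) * q) := by
    simp only [map_one, map_neg]; ring
  have hd : ((C 1 * X + C (-1)) * q).natDegree ≤ N + 1 := by
    refine natDegree_mul_le.trans ?_
    have := natDegree_linear_le (a := (1 : R)) (b := -1)
    omega
  rw [e, homEval_linear_mul hd, homEval_linear_mul hq]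
  ring

lemma natDegree_prod_linear_le {R ι : Type*} [CommRing R] (s : Finset ι) (a b : ι → R) :
    (∏ i ∈ s, (C (a i) * X + C (b i))).natDegree ≤ #s := by
  refine (natDegree_prod_le _ _).trans ?_
  refine (sum_le_card_nsmul _ _ 1 fun i _ => natDegree_linear_le).trans (by simp)

lemma homEval_prod_linear {R ι : Type*} [CommRing R] (s : Finset ι) (a b : ι → R) (x y : R) :
    homEval #s (∏ i ∈ s, (C (a i) * X + C (b i))) x y = ∏ i ∈ s, (a i * x + b i * y) := by
  classical
  induction s using Finset.induction_on with
  | empty => simp [homEval]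
  | insert i s hi ih =>
    rw [prod_insert hi, prod_insert hi, card_insert_of_notMem hi,
      homEval_linear_mul (natDegree_prod_linear_le s a b), ih]

/-- The polynomial `∏_{a = 0}^{D} (a X + D - a)` with `D = 2 n - 3`. -/
def linePoly (n : ℕ) : ℤ[X] :=
  ∏ a ∈ range (2 * n - 3 + 1), (C (a : ℤ) * X + C (2 * (n : ℤ) - 3 - a))

/-- The number of lines on a generic hypersurface of degree `2 n - 3` in `ℙⁿ`, as a difference
of two consecutive coefficients. -/
def lineCount (n : ℕ) : ℤ := (linePoly n).coeff (n - 1) - (linePoly n).coeff n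

/-- `linePoly` is palindromic: the substitution `a ↦ D - a` exchanges the coefficients of each
linear factor. -/
lemma linePoly_reflect {n : ℕ} (hn : 2 ≤ n) :
    (linePoly n).reflect (2 * n - 3 + 1) = linePoly n := by
  have key : ∀ (s : Finset ℕ) (a b : ℕ → ℤ),
      (∏ i ∈ s, (C (a i) * X + C (b i))).reflect #s = ∏ i ∈ s, (C (b i) * X + C (a i)) := by
    intro s a b
    induction s using Finset.induction_on with
    | empty => simp
    | insert i s hi ih =>
      rw [prod_insert hi, prod_insert hi, card_insert_of_notMem hi, add_comm,
        reflect_mul _ _ natDegree_linear_le (natDegree_prod_linear_le s a b), ih, reflect_add,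
        reflect_C, reflect_C_mul, reflect_one_X]
      ring
  have h := key (range (2 * n - 3 + 1)) (fun a => (a : ℤ)) (fun a => 2 * (n : ℤ) - 3 - a)
  rw [card_range] at h
  rw [linePoly, h, ← prod_range_reflect]
  refine prod_congr rfl fun a ha => ?_
  have : ((2 * n - 3 + 1 - 1 - a : ℕ) : ℤ) = 2 * (n : ℤ) - 3 - a := by
    have := mem_range.1 ha
    omega
  rw [this, sub_sub_cancel]

lemma coeff_sq_mul_linePoly {n : ℕ} (hn : 2 ≤ n) :
    ((X - 1) ^ 2 * linePoly n).coeff n = -2 * lineCount n := by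
  obtain ⟨m, rfl⟩ := Nat.exists_eq_add_of_le' hn
  have h : (linePoly (m + 2)).coeff m = (linePoly (m + 2)).coeff (m + 2) := by
    conv_lhs => rw [← linePoly_reflect hn]
    rw [coeff_reflect, revAt_le (by omega)]
    congr 1
    omega
  have e : (X - 1) ^ 2 * linePoly (m + 2)
      = X * (X * linePoly (m + 2)) - C 2 * (X * linePoly (m + 2)) + linePoly (m + 2) := by
    rw [C_ofNat]
    ring
  rw [e, coeff_add, coeff_sub, coeff_C_mul, coeff_X_mul, coeff_X_mul, coeff_X_mul, h, lineCount]
  have : m + 2 - 1 = m + 1 := by omega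
  rw [this]
  ring

/-- The divided difference of order `n` of `x ^ m` for `m ≤ n`. -/
lemma sum_pow_div_prod_sub {n : ℕ} {w : Fin (n + 1) → ℂ} (hw : Function.Injective w) {m : ℕ}
    (hm : m ≤ n) :
    ∑ i, w i ^ m / ∏ k ∈ univ.erase i, (w i - w k) = if m = n then 1 else 0 := by
  have h := Lagrange.coeff_eq_sum (s := univ) (v := w) hw.injOn (P := (X : ℂ[X]) ^ m) (by
    rw [degree_X_pow, card_univ, Fintype.card_fin]; exact_mod_cast Nat.lt_succ_of_le hm)
  rw [card_univ, Fintype.card_fin, Nat.add_sub_cancel, coeff_X_pow] at h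
  simp only [eval_pow, eval_X] at h
  rw [← h]
  simp [eq_comm]

/-- The double sum over all pairs extracts the coefficient of `x ^ n y ^ n` of a form of
degree `2 n`. -/
lemma sum_homEval_div {n : ℕ} {w : Fin (n + 1) → ℂ} (hw : Function.Injective w) (q : ℂ[X]) :
    ∑ i, ∑ j, homEval (2 * n) q (w i) (w j) /
      ((∏ k ∈ univ.erase i, (w i - w k)) * ∏ k ∈ univ.erase j, (w j - w k)) = q.coeff n := by
  set d : Fin (n + 1) → ℂ := fun i => ∏ k ∈ univ.erase i, (w i - w k)
  have h1 : ∀ i j, homEval (2 * n) q (w i) (w j) / (d i * d j)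
      = ∑ p ∈ antidiagonal (2 * n), q.coeff p.1 * ((w i ^ p.1 / d i) * (w j ^ p.2 / d j)) := by
    intro i j
    rw [homEval, sum_div]
    exact sum_congr rfl fun p _ => by
      rw [mul_assoc, mul_div_assoc, mul_div_mul_comm]
  change ∑ i, ∑ j, homEval (2 * n) q (w i) (w j) / (d i * d j) = _
  simp_rw [h1]
  have h2 : ∑ i, ∑ j, ∑ p ∈ antidiagonal (2 * n),
        q.coeff p.1 * ((w i ^ p.1 / d i) * (w j ^ p.2 / d j))
      = ∑ p ∈ antidiagonal (2 * n),
        q.coeff p.1 * ((∑ i, w i ^ p.1 / d i) * (∑ j, w j ^ p.2 / d j)) := by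
    simp_rw [sum_mul_sum, mul_sum]
    exact (sum_congr rfl fun i _ => sum_comm).trans sum_comm
  rw [h2, sum_eq_single (n, n)]
  · rw [sum_pow_div_prod_sub hw le_rfl]; simp
  · rintro ⟨a, b⟩ hab hne
    rw [HasAntidiagonal.mem_antidiagonal] at hab
    simp only at hab ⊢
    rcases lt_trichotomy a n with h | h | h
    · rw [sum_pow_div_prod_sub hw h.le, if_neg h.ne]; simp
    · exact absurd (by ext <;> simp <;> omega) hne
    · rw [sum_pow_div_prod_sub (m := b) hw (by omega), if_neg (by omega)]; simp
  · intro h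
    exact absurd (HasAntidiagonal.mem_antidiagonal.2 (two_mul n).symm) h

lemma sum_eq_two_mul_sum_lt {n : ℕ} (T : Fin n → Fin n → ℂ) (hs : ∀ i j, T i j = T j i)
    (h0 : ∀ i, T i i = 0) :
    ∑ i, ∑ j, T i j = 2 * ∑ i, ∑ j ∈ univ.filter (fun j => i < j), T i j := by
  have h1 : ∑ i, ∑ j ∈ univ.filter (fun j => i < j), T i j
      = ∑ i, ∑ j ∈ univ.filter (fun j => j < i), T i j := by
    rw [sum_comm' (t' := univ) (s' := fun j => univ.filter (fun i => i < j)) (by simp)]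
    exact sum_congr rfl fun i _ => sum_congr rfl fun j _ => hs _ _
  rw [two_mul]
  nth_rewrite 2 [h1]
  rw [← sum_add_distrib]
  refine sum_congr rfl fun i _ => ?_
  rw [← sum_filter_add_sum_filter_not univ (fun j => i < j)]
  congr 1
  have : univ.filter (fun j => ¬ i < j) = insert i (univ.filter (fun j => j < i)) := by
    ext j; simp [le_iff_eq_or_lt]
  rw [this, sum_insert (by simp), h0, zero_add]

lemma homEval_linePoly {n : ℕ} (hn : 2 ≤ n) (x y : ℂ) :
    homEval (2 * n) (((X - 1) ^ 2 * linePoly n).map (Int.castRingHom ℂ)) x y = (x - y) ^ 2 *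
      ∏ a ∈ range (2 * n - 3 + 1), ((a : ℂ) * x + (2 * (n : ℂ) - 3 - (a : ℂ)) * y) := by
  have e1 : (linePoly n).map (Int.castRingHom ℂ) =
      ∏ a ∈ range (2 * n - 3 + 1), (C (a : ℂ) * X + C (2 * (n : ℂ) - 3 - (a : ℂ))) := by
    rw [linePoly, Polynomial.map_prod]
    refine prod_congr rfl fun a _ => ?_
    simp [C_ofNat]
  have hdeg := natDegree_prod_linear_le (range (2 * n - 3 + 1)) (fun a => (a : ℂ))
    (fun a => 2 * (n : ℂ) - 3 - (a : ℂ))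
  have hh := homEval_prod_linear (range (2 * n - 3 + 1)) (fun a => (a : ℂ))
    (fun a => 2 * (n : ℂ) - 3 - (a : ℂ)) x y
  rw [card_range] at hdeg hh
  have hN : 2 * n = (2 * n - 3 + 1) + 2 := by omega
  rw [← hh, ← homEval_sq_mul hdeg, ← hN, ← e1]
  simp

theorem localizationSum_eq {n : ℕ} (hn : 2 ≤ n) {w : Fin (n + 1) → ℂ}
    (hw : Function.Injective w) : localizationSum n w = (lineCount n : ℂ) := by
  set d : Fin (n + 1) → ℂ := fun i => ∏ k ∈ univ.erase i, (w i - w k) with hd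
  set F : ℂ → ℂ → ℂ := fun x y =>
    ∏ a ∈ range (2 * n - 3 + 1), ((a : ℂ) * x + (2 * (n : ℂ) - 3 - (a : ℂ)) * y) with hF
  set q : ℂ[X] := ((X - 1) ^ 2 * linePoly n).map (Int.castRingHom ℂ) with hq
  have hG : ∀ x y, homEval (2 * n) q x y = (x - y) ^ 2 * F x y := homEval_linePoly hn
  have hFs : ∀ x y, F x y = F y x := by
    intro x y
    simp only [hF]
    rw [← prod_range_reflect]
    refine prod_congr rfl fun a ha => ?_
    have : ((2 * n - 3 + 1 - 1 - a : ℕ) : ℂ) = 2 * (n : ℂ) - 3 - a := by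
      have h1 := mem_range.1 ha
      have : ((2 * n - 3 + 1 - 1 - a : ℕ) : ℤ) = 2 * (n : ℤ) - 3 - a := by omega
      exact_mod_cast congrArg (Int.cast : ℤ → ℂ) this
    rw [this]
    ring
  set T : Fin (n + 1) → Fin (n + 1) → ℂ := fun i j =>
    homEval (2 * n) q (w i) (w j) / (d i * d j) with hT
  have hterm : ∀ i j, i < j → F (w i) (w j) /
      ∏ k ∈ univ.filter (fun k => k ≠ i ∧ k ≠ j), ((w i - w k) * (w j - w k)) = - T i j := by
    intro i j hij
    have hne : w i - w j ≠ 0 := sub_ne_zero.2 (hw.ne hij.ne)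
    have f1 : univ.erase i = insert j (univ.filter (fun k => k ≠ i ∧ k ≠ j)) := by
      ext k; simp; grind
    have f2 : univ.erase j = insert i (univ.filter (fun k => k ≠ i ∧ k ≠ j)) := by
      ext k; simp; grind
    have g1 : d i = (w i - w j) * ∏ k ∈ univ.filter (fun k => k ≠ i ∧ k ≠ j), (w i - w k) := by
      rw [hd]; simp only; rw [f1, prod_insert (by simp)]
    have g2 : d j = (w j - w i) * ∏ k ∈ univ.filter (fun k => k ≠ i ∧ k ≠ j), (w j - w k) := by
      rw [hd]; simp only; rw [f2, prod_insert (by simp)]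
    rw [hT]
    simp only
    rw [hG, g1, g2, prod_mul_distrib]
    have hj : w j - w i = -(w i - w j) := by ring
    rw [hj, show (w i - w j) * (∏ k ∈ univ.filter (fun k => k ≠ i ∧ k ≠ j), (w i - w k)) *
      (-(w i - w j) * ∏ k ∈ univ.filter (fun k => k ≠ i ∧ k ≠ j), (w j - w k))
      = -((w i - w j) ^ 2 * ((∏ k ∈ univ.filter (fun k => k ≠ i ∧ k ≠ j), (w i - w k)) *
       ∏ k ∈ univ.filter (fun k => k ≠ i ∧ k ≠ j), (w j - w k))) by ring, div_neg, neg_neg,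
       mul_div_mul_left _ _ (pow_ne_zero 2 hne)]
  have hsum := sum_homEval_div hw q
  have htwo := sum_eq_two_mul_sum_lt T (fun i j => by
      simp only [hT, hG]; rw [hFs, mul_comm (d i)]; ring) (fun i => by simp [hT, hG])
  have hloc : localizationSum n w = - ∑ i, ∑ j ∈ univ.filter (fun j => i < j), T i j := by
    rw [localizationSum, ← sum_neg_distrib]
    refine sum_congr rfl fun i _ => ?_
    rw [← sum_neg_distrib]
    exact sum_congr rfl fun j hj => hterm i j (by simpa using hj)
  have hc : q.coeff n = -2 * (lineCount n : ℂ) := by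
    rw [hq, coeff_map, coeff_sq_mul_linePoly hn]; simp
  rw [hloc]
  have : 2 * ∑ i, ∑ j ∈ univ.filter (fun j => i < j), T i j = -2 * (lineCount n : ℂ) := by
    rw [← htwo, ← hc, ← hsum]
  linear_combination (-1 / 2 : ℂ) * this

/-! ### The trigonometric integral -/

lemma integral_exp_two_mul_int (k : ℤ) :
    ∫ θ in (0 : ℝ)..Real.pi, Complex.exp (2 * k * Complex.I * θ) =
      if k = 0 then (Real.pi : ℂ) else 0 := by
  split_ifs with h
  · simp [h]
  · have hk : (2 * k * Complex.I : ℂ) ≠ 0 := by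
      simp [Complex.I_ne_zero, h]
    rw [integral_exp_mul_complex hk]
    have : Complex.exp (2 * k * Complex.I * (Real.pi : ℝ)) = 1 := by
      rw [Complex.exp_eq_one_iff]
      exact ⟨k, by ring⟩
    simp [this]

lemma prod_pair_linear (N : ℕ) (c s : ℂ) :
    ∏ a ∈ range (2 * N), ((2 * (N : ℂ) - 1) * c + Complex.I * (2 * a - (2 * N - 1)) * s) =
      ∏ l ∈ range N, ((2 * (N : ℂ) - 1) ^ 2 * c ^ 2 + (2 * (l : ℂ) + 1) ^ 2 * s ^ 2) := by
  rw [two_mul N, prod_range_add, ← prod_range_reflect, ← prod_mul_distrib]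
  refine prod_congr rfl fun l hl => ?_
  have hl' := mem_range.1 hl
  have : ((N - 1 - l : ℕ) : ℂ) = N - 1 - l := by
    rw [Nat.cast_sub (by omega), Nat.cast_sub (by omega)]
    simp
  rw [this]
  push_cast
  linear_combination -(2 * (l : ℂ) + 1) ^ 2 * s ^ 2 * Complex.I_sq

/-- The integrand of the trigonometric integral for the number of lines, with `N = n - 1`; then
`2 * N - 1` is the degree `2 * n - 3`. -/
def angularIntegrand (N : ℕ) (θ : ℝ) : ℝ :=
  Real.sin θ ^ 2 *
    ∏ l ∈ range N, ((2 * (N : ℝ) - 1) ^ 2 * Real.cos θ ^ 2 + (2 * (l : ℝ) + 1) ^ 2 * Real.sin θ ^ 2)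

lemma continuous_angularIntegrand (N : ℕ) : Continuous (angularIntegrand N) := by
  unfold angularIntegrand
  fun_prop

lemma homEval_linePoly_exp {N : ℕ} (hN : 1 ≤ N) (θ : ℝ) :
    homEval (2 * (N + 1)) (((X - 1) ^ 2 * linePoly (N + 1)).map (Int.castRingHom ℂ))
      (Complex.exp (θ * Complex.I)) (Complex.exp (-θ * Complex.I)) =
      ((-4 * angularIntegrand N θ : ℝ) : ℂ) := by
  have e1 : 2 * (N + 1) - 3 + 1 = 2 * N := by omega
  rw [homEval_linePoly (by omega), e1, Complex.exp_mul_I, Complex.exp_mul_I, Complex.cos_neg,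
    Complex.sin_neg]
  set c := Complex.cos θ with hc
  set s := Complex.sin θ with hs
  have e2 : ∀ a : ℕ, (a : ℂ) * (c + s * Complex.I) +
      (2 * ((N + 1 : ℕ) : ℂ) - 3 - a) * (c + -s * Complex.I) =
      (2 * (N : ℂ) - 1) * c + Complex.I * (2 * a - (2 * N - 1)) * s := by
    intro a
    push_cast
    ring
  simp_rw [e2]
  rw [prod_pair_linear, angularIntegrand]
  push_cast
  rw [← hc, ← hs]
  linear_combination (4 * s ^ 2 * ∏ l ∈ range N, ((2 * (N : ℂ) - 1) ^ 2 * c ^ 2 +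
    (2 * (l : ℂ) + 1) ^ 2 * s ^ 2)) * Complex.I_sq

lemma integral_homEval_exp (n : ℕ) (q : ℂ[X]) :
    ∫ θ in (0 : ℝ)..Real.pi, homEval (2 * n) q
      (Complex.exp (θ * Complex.I)) (Complex.exp (-θ * Complex.I)) = Real.pi * q.coeff n := by
  have h1 : ∀ θ : ℝ, homEval (2 * n) q (Complex.exp (θ * Complex.I)) (Complex.exp (-θ * Complex.I))
      = ∑ p ∈ HasAntidiagonal.antidiagonal (2 * n),
        q.coeff p.1 * Complex.exp (2 * ((p.1 - n : ℤ) : ℂ) * Complex.I * θ) := by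
    intro θ
    refine sum_congr rfl fun p hp => ?_
    have hp' : (p.1 : ℂ) + p.2 = 2 * n := by
      exact_mod_cast HasAntidiagonal.mem_antidiagonal.1 hp
    rw [mul_assoc, ← Complex.exp_nat_mul, ← Complex.exp_nat_mul, ← Complex.exp_add]
    congr 2
    push_cast
    linear_combination (-(θ : ℂ) * Complex.I) * hp'
  simp_rw [h1]
  rw [intervalIntegral.integral_finsetSum
    (fun p _ => (by fun_prop : Continuous _).intervalIntegrable _ _)]
  simp_rw [intervalIntegral.integral_const_mul, integral_exp_two_mul_int]
  rw [sum_eq_single (n, n)]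
  · simp [mul_comm]
  · rintro ⟨a, b⟩ hab hne
    rw [HasAntidiagonal.mem_antidiagonal] at hab
    simp only at hab ⊢
    rw [if_neg, mul_zero]
    intro h
    exact hne (by ext <;> simp <;> omega)
  · intro h
    exact absurd (HasAntidiagonal.mem_antidiagonal.2 (two_mul n).symm) h

theorem lineCount_eq_integral {N : ℕ} (hN : 1 ≤ N) :
    (lineCount (N + 1) : ℝ) =
      4 / Real.pi * ∫ θ in (0 : ℝ)..(Real.pi / 2), angularIntegrand N θ := by
  have h := integral_homEval_exp (N + 1) (((X - 1) ^ 2 * linePoly (N + 1)).map (Int.castRingHom ℂ))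
  simp_rw [homEval_linePoly_exp hN] at h
  rw [intervalIntegral.integral_ofReal, coeff_map, coeff_sq_mul_linePoly (by omega)] at h
  have h' : ∫ θ in (0 : ℝ)..Real.pi, -4 * angularIntegrand N θ =
      Real.pi * (-2 * (lineCount (N + 1) : ℝ)) := by
    apply Complex.ofReal_injective
    rw [h]
    simp
  rw [intervalIntegral.integral_const_mul] at h'
  have hI : ∀ a b, IntervalIntegrable (angularIntegrand N) MeasureTheory.volume a b := fun a b =>
    (continuous_angularIntegrand N).intervalIntegrable a b
  have hsym : ∫ θ in (Real.pi / 2)..Real.pi, angularIntegrand N θ =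
      ∫ θ in (0 : ℝ)..(Real.pi / 2), angularIntegrand N θ := by
    have := intervalIntegral.integral_comp_sub_left (a := 0) (b := Real.pi / 2)
      (angularIntegrand N) Real.pi
    rw [sub_zero, sub_half] at this
    rw [← this]
    congr 1
    ext θ
    simp [angularIntegrand]
  rw [← intervalIntegral.integral_add_adjacent_intervals (hI 0 (Real.pi / 2)) (hI _ _), hsym] at h'
  have := Real.pi_ne_zero
  field_simp
  linarith

theorem lineCount_pos {n : ℕ} (hn : 2 ≤ n) : 0 < lineCount n := by
  obtain ⟨N, rfl⟩ : ∃ N, n = N + 1 := ⟨n - 1, by omega⟩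
  have hN : 1 ≤ N := by omega
  have : (0 : ℝ) < lineCount (N + 1) := by
    rw [lineCount_eq_integral hN]
    have hpi := Real.pi_pos
    refine mul_pos (by positivity) ?_
    refine intervalIntegral.intervalIntegral_pos_of_pos_on
      ((continuous_angularIntegrand N).intervalIntegrable _ _) (fun θ hθ => ?_) (by positivity)
    have hs : 0 < Real.sin θ := Real.sin_pos_of_pos_of_lt_pi hθ.1 (by linarith [hθ.2])
    exact mul_pos (by positivity) (prod_pos fun l _ => by positivity)
  exact_mod_cast this

/-! ### A calculus of asymptotic expansions -/

/-- The data for a calculus of uniform asymptotic expansions: a small parameter `eps` with values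
in `[0, 1]` and a weight `wt ≥ 1` on a set `carrier` of parameters, and a ring `R` of coefficients,
each of which is evaluated at every parameter and grows at most polynomially in the weight. -/
structure Scale (α R : Type*) [CommRing R] where
  carrier : Set α
  eps : α → ℝ
  wt : α → ℝ
  ev : α → R →+* ℝ
  eps_nonneg : ∀ a ∈ carrier, 0 ≤ eps a
  eps_le_one : ∀ a ∈ carrier, eps a ≤ 1
  one_le_wt : ∀ a ∈ carrier, 1 ≤ wt a
  ev_bound : ∀ r, ∃ (C : ℝ) (M : ℕ), ∀ a ∈ carrier, |ev a r| ≤ C * wt a ^ M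

namespace Scale

variable {α R : Type*} [CommRing R] (Γ : Scale α R)

/-- `g` is `O(eps ^ K)`, uniformly up to a power of the weight. -/
def Small (K : ℕ) (g : α → ℝ) : Prop :=
  ∃ (C : ℝ) (M : ℕ), 0 ≤ C ∧ ∀ a ∈ Γ.carrier, |g a| ≤ C * Γ.wt a ^ M * Γ.eps a ^ K

/-- The value at the parameter `a` of a polynomial in the small parameter. -/
def evp (p : R[X]) (a : α) : ℝ := p.eval₂ (Γ.ev a) (Γ.eps a)

/-- `f` has the asymptotic expansion `F` in powers of the small parameter: for every order `K`, it
agrees up to `O(eps ^ K)` with a polynomial in `eps` that has the coefficients of `F` in all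
degrees below `K`. -/
def HasExp (f : α → ℝ) (F : PowerSeries R) : Prop :=
  ∀ K : ℕ, ∃ p : R[X], (∀ k < K, p.coeff k = PowerSeries.coeff k F) ∧
    Γ.Small K (fun a => f a - Γ.evp p a)

variable {Γ}

lemma Small.congr {K : ℕ} {f g : α → ℝ} (hf : Γ.Small K f) (h : ∀ a ∈ Γ.carrier, f a = g a) :
    Γ.Small K g := by
  obtain ⟨C, M, hC, hb⟩ := hf
  exact ⟨C, M, hC, fun a ha => h a ha ▸ hb a ha⟩

lemma Small.of_abs_le {K : ℕ} {f g : α → ℝ} (hg : Γ.Small K g)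
    (h : ∀ a ∈ Γ.carrier, |f a| ≤ |g a|) : Γ.Small K f := by
  obtain ⟨C, M, hC, hb⟩ := hg
  exact ⟨C, M, hC, fun a ha => (h a ha).trans (hb a ha)⟩

lemma Small.mono {K L : ℕ} {f : α → ℝ} (hf : Γ.Small K f) (h : L ≤ K) : Γ.Small L f := by
  obtain ⟨C, M, hC, hb⟩ := hf
  refine ⟨C, M, hC, fun a ha => (hb a ha).trans ?_⟩
  have h0 := Γ.eps_nonneg a ha
  have h1 := Γ.one_le_wt a ha
  have := pow_le_pow_of_le_one h0 (Γ.eps_le_one a ha) h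
  gcongr

lemma Small.mul {K L : ℕ} {f g : α → ℝ} (hf : Γ.Small K f) (hg : Γ.Small L g) :
    Γ.Small (K + L) (fun a => f a * g a) := by
  obtain ⟨C, M, hC, hb⟩ := hf
  obtain ⟨C', M', hC', hb'⟩ := hg
  refine ⟨C * C', M + M', mul_nonneg hC hC', fun a ha => ?_⟩
  have h0 := Γ.eps_nonneg a ha
  have h1 := Γ.one_le_wt a ha
  rw [abs_mul]
  refine (mul_le_mul (hb a ha) (hb' a ha) (abs_nonneg _) (by positivity)).trans_eq ?_
  ring

lemma Small.add {K : ℕ} {f g : α → ℝ} (hf : Γ.Small K f) (hg : Γ.Small K g) :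
    Γ.Small K (fun a => f a + g a) := by
  obtain ⟨C, M, hC, hb⟩ := hf
  obtain ⟨C', M', hC', hb'⟩ := hg
  refine ⟨C + C', max M M', add_nonneg hC hC', fun a ha => (abs_add_le _ _).trans ?_⟩
  have h0 := Γ.eps_nonneg a ha
  have h1 := Γ.one_le_wt a ha
  have e1 : |f a| ≤ C * Γ.wt a ^ max M M' * Γ.eps a ^ K := by
    refine (hb a ha).trans ?_
    have := pow_le_pow_right₀ h1 (le_max_left M M')
    gcongr
  have e2 : |g a| ≤ C' * Γ.wt a ^ max M M' * Γ.eps a ^ K := by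
    refine (hb' a ha).trans ?_
    have := pow_le_pow_right₀ h1 (le_max_right M M')
    gcongr
  linarith

lemma Small.neg {K : ℕ} {f : α → ℝ} (hf : Γ.Small K f) : Γ.Small K (fun a => -f a) :=
  hf.of_abs_le fun a _ => by rw [abs_neg]

lemma small_zero (K : ℕ) : Γ.Small K (fun _ => 0) :=
  ⟨0, 0, le_rfl, fun a _ => by simp⟩

lemma small_ev (r : R) : Γ.Small 0 (fun a => Γ.ev a r) := by
  obtain ⟨C, M, h⟩ := Γ.ev_bound r
  refine ⟨max C 0, M, le_max_right _ _, fun a ha => (h a ha).trans ?_⟩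
  have h1 := Γ.one_le_wt a ha
  rw [pow_zero, mul_one]
  gcongr
  exact le_max_left _ _

lemma small_eps_pow (K : ℕ) : Γ.Small K (fun a => Γ.eps a ^ K) :=
  ⟨1, 0, zero_le_one, fun a ha => by
    rw [abs_of_nonneg (pow_nonneg (Γ.eps_nonneg a ha) _)]; simp⟩

lemma small_const (c : ℝ) : Γ.Small 0 (fun _ => c) :=
  ⟨|c|, 0, abs_nonneg _, fun a _ => by simp⟩

lemma Small.pow {K : ℕ} {f : α → ℝ} (hf : Γ.Small K f) (j : ℕ) :
    Γ.Small (j * K) (fun a => f a ^ j) := by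
  induction j with
  | zero => simpa using small_const 1
  | succ j ih =>
    simp_rw [pow_succ]
    rw [Nat.succ_mul]
    exact ih.mul hf

lemma small_evp_zero (p : R[X]) : Γ.Small 0 (Γ.evp p) := by
  induction p using Polynomial.induction_on' with
  | add p q hp hq => exact (hp.add hq).congr fun a _ => by simp [evp, eval₂_add]
  | monomial n r =>
    exact (((small_ev r).mul (small_eps_pow n)).mono (Nat.zero_le _)).congr fun a _ => by
      simp [evp, eval₂_monomial]

lemma small_evp {K : ℕ} {p : R[X]} (hp : ∀ k < K, p.coeff k = 0) : Γ.Small K (Γ.evp p) := by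
  obtain ⟨q, rfl⟩ := X_pow_dvd_iff.2 hp
  exact ((small_eps_pow K).mul (small_evp_zero q)).congr fun a _ => by
    simp [evp, eval₂_mul, eval₂_pow]

variable {f g : α → ℝ} {F G : PowerSeries R}

lemma HasExp.congr (hf : Γ.HasExp f F) (h : ∀ a ∈ Γ.carrier, f a = g a) : Γ.HasExp g F := by
  intro K
  obtain ⟨p, hp, hs⟩ := hf K
  exact ⟨p, hp, hs.congr fun a ha => by rw [h a ha]⟩

lemma hasExp_evp (p : R[X]) : Γ.HasExp (Γ.evp p) (p : PowerSeries R) := fun K =>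
  ⟨p, fun k _ => by simp, by simpa using small_zero K⟩

lemma HasExp.small_zero (hf : Γ.HasExp f F) : Γ.Small 0 f := by
  obtain ⟨p, _, hs⟩ := hf 0
  exact (hs.add (small_evp_zero p)).congr fun a _ => by ring

lemma HasExp.small_one (hf : Γ.HasExp f F) (h0 : PowerSeries.coeff 0 F = 0) : Γ.Small 1 f := by
  obtain ⟨p, hp, hs⟩ := hf 1
  refine (hs.add (small_evp (p := p) (K := 1) fun k hk => ?_)).congr fun a _ => by ring
  rw [hp k hk, Nat.lt_one_iff.1 hk, h0]

/-- The remainder after the terms of order below `K`. -/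
lemma HasExp.small_sub_sum (hf : Γ.HasExp f F) (K : ℕ) :
    Γ.Small K (fun a => f a - ∑ k ∈ range K, Γ.ev a (PowerSeries.coeff k F) * Γ.eps a ^ k) := by
  obtain ⟨p, hp, hs⟩ := hf K
  have h := small_evp (Γ := Γ) (K := K)
    (p := p - ∑ k ∈ range K, monomial k (PowerSeries.coeff k F)) (fun k hk => by
      rw [coeff_sub, finsetSum_coeff, sum_eq_single k, coeff_monomial_same, hp k hk, sub_self]
      · intro b _ hb
        exact coeff_monomial_of_ne _ hb.symm
      · intro h
        exact absurd (mem_range.2 hk) h)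
  refine (hs.add h).congr fun a _ => ?_
  simp [evp, eval₂_sub, eval₂_finsetSum, eval₂_monomial]

lemma hasExp_of_small_sub_sum
    (h : ∀ K, Γ.Small K
      (fun a => f a - ∑ k ∈ range K, Γ.ev a (PowerSeries.coeff k F) * Γ.eps a ^ k)) :
    Γ.HasExp f F := by
  intro K
  refine ⟨∑ k ∈ range K, monomial k (PowerSeries.coeff k F), fun k hk => ?_,
    (h K).congr fun a _ => by simp [evp, eval₂_finsetSum, eval₂_monomial]⟩
  rw [finsetSum_coeff, sum_eq_single k, coeff_monomial_same]
  · intro b _ hb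
    exact coeff_monomial_of_ne _ hb.symm
  · intro h
    exact absurd (mem_range.2 hk) h

lemma HasExp.add (hf : Γ.HasExp f F) (hg : Γ.HasExp g G) :
    Γ.HasExp (fun a => f a + g a) (F + G) := by
  intro K
  obtain ⟨p, hp, hs⟩ := hf K
  obtain ⟨q, hq, ht⟩ := hg K
  refine ⟨p + q, fun k hk => by rw [coeff_add, map_add, hp k hk, hq k hk],
    (hs.add ht).congr fun a _ => ?_⟩
  simp only [evp, eval₂_add]
  ring

lemma HasExp.neg (hf : Γ.HasExp f F) : Γ.HasExp (fun a => -f a) (-F) := by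
  intro K
  obtain ⟨p, hp, hs⟩ := hf K
  refine ⟨-p, fun k hk => by rw [coeff_neg, map_neg, hp k hk], hs.neg.congr fun a _ => ?_⟩
  simp only [evp, eval₂_neg]
  ring

lemma HasExp.sub (hf : Γ.HasExp f F) (hg : Γ.HasExp g G) :
    Γ.HasExp (fun a => f a - g a) (F - G) := by
  simpa only [sub_eq_add_neg] using hf.add hg.neg

lemma HasExp.mul (hf : Γ.HasExp f F) (hg : Γ.HasExp g G) :
    Γ.HasExp (fun a => f a * g a) (F * G) := by
  intro K
  obtain ⟨p, hp, hs⟩ := hf K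
  obtain ⟨q, hq, ht⟩ := hg K
  refine ⟨p * q, fun k hk => ?_, ?_⟩
  · rw [coeff_mul, PowerSeries.coeff_mul]
    refine sum_congr rfl fun x hx => ?_
    have := HasAntidiagonal.mem_antidiagonal.1 hx
    rw [hp _ (by omega), hq _ (by omega)]
  · refine ((hs.mul hg.small_zero).add
      (((small_evp_zero p).mul ht).mono (by omega))).congr fun a _ => ?_
    simp only [evp, eval₂_mul]
    ring

lemma HasExp.pow (hf : Γ.HasExp f F) (j : ℕ) : Γ.HasExp (fun a => f a ^ j) (F ^ j) := by
  induction j with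
  | zero =>
    have := hasExp_evp (Γ := Γ) (1 : R[X])
    rw [Polynomial.coe_one] at this
    rw [pow_zero]
    exact this.congr fun a _ => by simp [evp]
  | succ j ih =>
    simp_rw [pow_succ]
    exact ih.mul hf

lemma hasExp_sum {ι : Type*} (s : Finset ι) {f : ι → α → ℝ} {F : ι → PowerSeries R}
    (hf : ∀ i ∈ s, Γ.HasExp (f i) (F i)) :
    Γ.HasExp (fun a => ∑ i ∈ s, f i a) (∑ i ∈ s, F i) := by
  classical
  induction s using Finset.induction_on with
  | empty =>
    intro K
    exact ⟨0, by simp, by simpa [evp] using Scale.small_zero K⟩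
  | insert i s hi ih =>
    simp_rw [sum_insert hi]
    exact (hf i (mem_insert_self _ _)).add (ih fun j hj => hf j (mem_insert_of_mem hj))

lemma coeff_pow_eq_zero {G : PowerSeries R} (h0 : PowerSeries.coeff 0 G = 0) {k j : ℕ}
    (h : k < j) : PowerSeries.coeff k (G ^ j) = 0 := by
  have : PowerSeries.X ∣ G := PowerSeries.X_dvd_iff.2 (by simpa using h0)
  exact PowerSeries.X_pow_dvd_iff.1 (pow_dvd_pow_of_dvd this j) k h

variable [Algebra ℚ R]

lemma evp_algebraMap (q : ℚ) (a : α) : Γ.ev a (algebraMap ℚ R q) = (q : ℝ) := by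
  rw [← RingHom.comp_apply, eq_ratCast]

lemma HasExp.const_mul (q : ℚ) (hf : Γ.HasExp f F) :
    Γ.HasExp (fun a => (q : ℝ) * f a) (q • F) := by
  have h := (hasExp_evp (Γ := Γ) (Polynomial.C (algebraMap ℚ R q))).mul hf
  have e : ((Polynomial.C (algebraMap ℚ R q) : R[X]) : PowerSeries R) * F = q • F := by
    rw [Polynomial.coe_C]
    ext k
    rw [PowerSeries.coeff_C_mul, Algebra.smul_def, PowerSeries.algebraMap_apply,
      PowerSeries.coeff_C_mul]
  rw [e] at h
  exact h.congr fun a _ => by simp only [evp, eval₂_C, evp_algebraMap]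

/-- The composition `∑_j d j * G ^ j` with a power series `G` without constant term. -/
def compSeries (d : ℕ → ℚ) (G : PowerSeries R) : PowerSeries R :=
  PowerSeries.mk fun k => ∑ j ∈ range (k + 1), d j • PowerSeries.coeff k (G ^ j)

lemma coeff_compSeries_of_lt (d : ℕ → ℚ) (h0 : PowerSeries.coeff 0 G = 0) {k K : ℕ}
    (hk : k < K) :
    PowerSeries.coeff k (compSeries d G) = PowerSeries.coeff k (∑ j ∈ range K, d j • G ^ j) := by
  rw [compSeries, PowerSeries.coeff_mk, map_sum]
  refine sum_subset_zero_on_sdiff (range_subset_range.2 (by omega)) (fun j hj => ?_)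
    fun j _ => ?_
  · rw [Finset.mem_sdiff, mem_range, mem_range] at hj
    rw [PowerSeries.coeff_smul, coeff_pow_eq_zero h0 (by omega), smul_zero]
  · rw [PowerSeries.coeff_smul]

/-- Expansions may be substituted into each other: if `h` is approximated to all orders by
`∑_j d j * g ^ j`, and `g` has an expansion without constant term, then `h` has the composed
expansion. -/
lemma HasExp.comp {h : α → ℝ} {d : ℕ → ℚ} (hg : Γ.HasExp g G)
    (h0 : PowerSeries.coeff 0 G = 0)
    (hh : ∀ K : ℕ, ∃ C : ℝ, 0 ≤ C ∧ ∀ a ∈ Γ.carrier,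
      |h a - ∑ j ∈ range K, (d j : ℝ) * g a ^ j| ≤ C * |g a| ^ K) :
    Γ.HasExp h (compSeries d G) := by
  intro K
  obtain ⟨C, hC, hb⟩ := hh K
  obtain ⟨p, hp, hs⟩ := hasExp_sum (range K) (fun j _ => (hg.pow j).const_mul (d j)) K
  refine ⟨p, fun k hk => (hp k hk).trans (coeff_compSeries_of_lt d h0 hk).symm, ?_⟩
  have h1 : Γ.Small K (fun a => h a - ∑ j ∈ range K, (d j : ℝ) * g a ^ j) := by
    have := ((hg.small_one h0).pow K).mul (small_const (Γ := Γ) C)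
    rw [mul_one, add_zero] at this
    refine this.of_abs_le fun a ha => (hb a ha).trans_eq ?_
    rw [abs_mul, abs_pow, abs_of_nonneg hC, mul_comm]
  exact (h1.add hs).congr fun a _ => by ring

end Scale

/-! ### The exponent and sums of powers of odd numbers -/

/-- The sum of even powers of the odd numbers below `D = 2 N - 1`, by the Faulhaber formula at
half-integers. The Bernoulli number `B 1` contributes to the second term, in which it is combined
with the last summand of the left-hand side. -/
lemma sum_odd_pow (N : ℕ) {j : ℕ} (hj : 1 ≤ j) :
    ∑ l ∈ range N, (2 * (l : ℚ) + 1) ^ (2 * j) =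
      (2 * (N : ℚ) - 1) ^ (2 * j + 1) / (2 * (2 * j + 1)) + (2 * (N : ℚ) - 1) ^ (2 * j) / 2 +
      ∑ i ∈ Icc 2 (2 * j), (2 : ℚ) ^ (i - 1) * (Nat.choose (2 * j + 1) i : ℚ) * bernoulli i *
        (2 * (N : ℚ) - 1) ^ (2 * j + 1 - i) / (2 * j + 1) := by
  have hhalf : (Polynomial.bernoulli (2 * j + 1)).eval (1 / 2 : ℚ) = 0 := by
    have := Polynomial.bernoulli_eval_one_sub (2 * j + 1) (1 / 2)
    rw [Odd.neg_one_pow ⟨j, rfl⟩] at this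
    norm_num at this ⊢
    linarith
  have h1 : ∀ N : ℕ, (2 * (j : ℚ) + 1) * ∑ l ∈ range N, (2 * (l : ℚ) + 1) ^ (2 * j) =
      2 ^ (2 * j) * (Polynomial.bernoulli (2 * j + 1)).eval (N + 1 / 2 : ℚ) := by
    intro N
    induction N with
    | zero =>
      rw [sum_range_zero, mul_zero]
      simp only [CharP.cast_eq_zero, zero_add, hhalf, mul_zero]
    | succ N ih =>
      have := Polynomial.bernoulli_eval_one_add (2 * j + 1) (N + 1 / 2 : ℚ)
      rw [sum_range_succ, mul_add, ih]
      rw [show ((N + 1 : ℕ) : ℚ) + 1 / 2 = 1 + (N + 1 / 2) by push_cast; ring, this,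
        show (2 * (N : ℚ) + 1) = 2 * (N + 1 / 2) by ring, mul_pow]
      push_cast
      ring
  have h2 := Polynomial.bernoulli_eval_one_add (2 * j + 1) ((2 * (N : ℚ) - 1) / 2)
  rw [show 1 + (2 * (N : ℚ) - 1) / 2 = N + 1 / 2 by ring] at h2
  have hj0 : (2 * (j : ℚ) + 1) ≠ 0 := by positivity
  set D : ℚ := 2 * N - 1 with hD
  have h3 : (Polynomial.bernoulli (2 * j + 1)).eval (D / 2) =
      (D / 2) ^ (2 * j + 1) - (2 * j + 1) / 2 * (D / 2) ^ (2 * j) +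
      ∑ i ∈ Icc 2 (2 * j), (D / 2) ^ (2 * j + 1 - i) *
        (bernoulli i * (Nat.choose (2 * j + 1) i : ℚ)) := by
    rw [Polynomial.bernoulli, eval_finsetSum]
    simp only [eval_monomial]
    rw [sum_range_succ, bernoulli_eq_zero_of_odd ⟨j, rfl⟩ (by omega), range_eq_Ico,
      sum_eq_sum_Ico_succ_bot (by omega), sum_eq_sum_Ico_succ_bot (by omega)]
    have : Ico (0 + 1 + 1) (2 * j + 1) = Icc 2 (2 * j) := by ext; simp
    rw [this]
    simp
    ring_nf
  have h4 := h1 N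
  rw [h2, h3] at h4
  have h5 : ∀ i ∈ Icc 2 (2 * j), (2 : ℚ) ^ (i - 1) * (Nat.choose (2 * j + 1) i : ℚ) *
      bernoulli i * D ^ (2 * j + 1 - i) / (2 * j + 1) = (2 ^ (2 * j) * ((D / 2) ^ (2 * j + 1 - i) *
        (bernoulli i * (Nat.choose (2 * j + 1) i : ℚ)))) / (2 * j + 1) := by
    intro i hi
    have hi' := mem_Icc.1 hi
    have e : (2 : ℚ) ^ (2 * j) = 2 ^ (i - 1) * 2 ^ (2 * j + 1 - i) := by
      rw [← pow_add]; congr 1; omega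
    rw [e, div_pow]
    field_simp
  rw [sum_congr rfl h5, ← sum_div, ← mul_sum]
  rw [← mul_right_inj' hj0, h4]
  have e : D ^ (2 * j) = 2 ^ (2 * j) * (D / 2) ^ (2 * j) := by rw [← mul_pow]; congr 1; ring
  rw [pow_succ D, e, pow_succ (D / 2)]
  push_cast
  field_simp
  ring

lemma exists_abs_aeval_le (r : ℚ[X]) :
    ∃ (C : ℝ) (M : ℕ), 0 ≤ C ∧ ∀ y : ℝ, |aeval y r| ≤ C * (1 + |y|) ^ M := by
  induction r using Polynomial.induction_on' with
  | add p q hp hq =>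
    obtain ⟨C, M, hC, h⟩ := hp
    obtain ⟨C', M', hC', h'⟩ := hq
    refine ⟨C + C', max M M', add_nonneg hC hC', fun y => ?_⟩
    have h1 : 1 ≤ 1 + |y| := by linarith [abs_nonneg y]
    rw [map_add]
    refine (abs_add_le _ _).trans ?_
    have e1 : C * (1 + |y|) ^ M ≤ C * (1 + |y|) ^ max M M' := by
      have := pow_le_pow_right₀ h1 (le_max_left M M')
      gcongr
    have e2 : C' * (1 + |y|) ^ M' ≤ C' * (1 + |y|) ^ max M M' := by
      have := pow_le_pow_right₀ h1 (le_max_right M M')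
      gcongr
    linarith [h y, h' y]
  | monomial n c =>
    refine ⟨|(c : ℝ)|, n, abs_nonneg _, fun y => ?_⟩
    have : |y| ≤ 1 + |y| := by linarith
    simp only [aeval_monomial, eq_ratCast, abs_mul, abs_pow]
    gcongr

/-- The scale for the Laplace method: `eps = 1 / D` with `D = 2 N - 1`, the variable `y` in the
range `0 ≤ y ≤ √D`, and polynomials in `y` as coefficients. -/
def laplaceScale : Scale (ℕ × ℝ) ℚ[X] where
  carrier := {a | 3 ≤ a.1 ∧ 0 ≤ a.2 ∧ a.2 ^ 2 ≤ 2 * (a.1 : ℝ) - 1}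
  eps a := 1 / (2 * (a.1 : ℝ) - 1)
  wt a := 1 + |a.2|
  ev a := (aeval a.2).toRingHom
  eps_nonneg := fun a ha => by
    have : (3 : ℝ) ≤ a.1 := by exact_mod_cast ha.1
    apply one_div_nonneg.2
    linarith
  eps_le_one := fun a ha => by
    have : (3 : ℝ) ≤ a.1 := by exact_mod_cast ha.1
    rw [div_le_one (by linarith)]
    linarith
  one_le_wt := fun a _ => by linarith [abs_nonneg a.2]
  ev_bound := fun r => by
    obtain ⟨C, M, -, h⟩ := exists_abs_aeval_le r
    exact ⟨C, M, fun a _ => h a.2⟩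

/-- The logarithm of the integrand relative to the Gaussian weight `exp (-y / 3)`, apart from the
factor `(1 + y / D) ^ (-2)`. -/
def logRatio (a : ℕ × ℝ) : ℝ :=
  a.2 / 3 + ∑ l ∈ range a.1,
      Real.log (1 + (2 * (l : ℝ) + 1) ^ 2 / (2 * (a.1 : ℝ) - 1) ^ 2 * (a.2 / (2 * (a.1 : ℝ) - 1))) -
    a.1 * Real.log (1 + a.2 / (2 * (a.1 : ℝ) - 1))

/-- The Taylor polynomial of degree `K` of `log (1 + x)`. -/
def logTaylor (K : ℕ) (x : ℝ) : ℝ := ∑ m ∈ range K, (-1) ^ m * x ^ (m + 1) / (m + 1)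

lemma abs_log_one_add_sub_le {x : ℝ} (hx : |x| ≤ 1 / 2) (K : ℕ) :
    |Real.log (1 + x) - logTaylor K x| ≤ 2 * |x| ^ (K + 1) := by
  have h := Real.abs_log_sub_add_sum_range_le (x := -x) (by rw [abs_neg]; linarith) K
  have e : ∑ i ∈ range K, (-x) ^ (i + 1) / ((i : ℝ) + 1) = - logTaylor K x := by
    rw [logTaylor, ← sum_neg_distrib]
    refine sum_congr rfl fun m _ => ?_
    rw [neg_pow, pow_succ (-1 : ℝ)]
    ring
  rw [e, sub_neg_eq_add, neg_add_eq_sub, abs_neg] at h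
  refine h.trans ?_
  rw [div_le_iff₀ (by linarith)]
  have : 0 ≤ |x| ^ (K + 1) := by positivity
  nlinarith

/-- The coefficient of `y ^ j ε ^ (i + j - 1)` in the part of the exponent with Bernoulli
numbers. -/
def bernoulliTerm (i j : ℕ) : ℚ :=
  (-1 : ℚ) ^ (j - 1) / ((j : ℚ) * (2 * (j : ℚ) + 1)) *
    (Nat.choose (2 * j + 1) i : ℚ) * bernoulli i * (2 : ℚ) ^ (i - 1)

lemma sum_odd_pow_div (N : ℕ) (hN : 3 ≤ N) (m : ℕ) (y : ℝ) :
    (-1) ^ m / ((m : ℝ) + 1) * ((∑ l ∈ range N,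
      ((2 * (l : ℝ) + 1) ^ 2 / (2 * (N : ℝ) - 1) ^ 2 * (y / (2 * (N : ℝ) - 1))) ^ (m + 1)) -
        N * (y / (2 * (N : ℝ) - 1)) ^ (m + 1)) =
      (-1) ^ (m + 1) / (2 * (m : ℝ) + 3) * y ^ (m + 1) * (1 / (2 * (N : ℝ) - 1)) ^ m +
      ∑ i ∈ Icc 2 (2 * (m + 1)),
        (bernoulliTerm i (m + 1) : ℝ) * y ^ (m + 1) * (1 / (2 * (N : ℝ) - 1)) ^ (m + i) := by
  have h := congrArg (fun q : ℚ => (q : ℝ)) (sum_odd_pow N (j := m + 1) (by omega))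
  push_cast at h
  have hN' : (3 : ℝ) ≤ N := by exact_mod_cast hN
  set D : ℝ := 2 * N - 1 with hD
  have hD0 : D ≠ 0 := by linarith
  have e1 : ∑ l ∈ range N, ((2 * (l : ℝ) + 1) ^ 2 / D ^ 2 * (y / D)) ^ (m + 1) =
      (∑ l ∈ range N, (2 * (l : ℝ) + 1) ^ (2 * (m + 1))) * (y ^ (m + 1) / D ^ (3 * (m + 1))) := by
    rw [sum_mul]
    refine sum_congr rfl fun l _ => ?_
    rw [mul_pow, div_pow, div_pow, ← pow_mul, ← pow_mul, show 3 * (m + 1) = 2 * (m + 1) + (m + 1) by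
      ring, pow_add D]
    field_simp
    ring
  have e2 : (N : ℝ) = D / 2 + 1 / 2 := by rw [hD]; ring
  have e3 : ∀ i ∈ Icc 2 (2 * (m + 1)), (2 : ℝ) ^ (i - 1) * (Nat.choose (2 * (m + 1) + 1) i : ℝ) *
      (bernoulli i : ℝ) * D ^ (2 * (m + 1) + 1 - i) / (2 * (m + 1) + 1) *
        (y ^ (m + 1) / D ^ (3 * (m + 1))) * ((-1) ^ m / ((m : ℝ) + 1)) =
      (bernoulliTerm i (m + 1) : ℝ) * y ^ (m + 1) * (1 / D) ^ (m + i) := by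
    intro i hi
    have hi' := mem_Icc.1 hi
    have e : D ^ (3 * (m + 1)) = D ^ (2 * (m + 1) + 1 - i) * D ^ (m + i) := by
      rw [← pow_add]; congr 1; omega
    rw [e, bernoulliTerm, Nat.add_sub_cancel, one_div, inv_pow]
    push_cast
    field_simp
  rw [e1, h, ← sum_congr rfl e3, ← sum_mul, ← sum_mul]
  rw [e2]
  generalize ∑ i ∈ Icc 2 (2 * (m + 1)), (2 : ℝ) ^ (i - 1) * (Nat.choose (2 * (m + 1) + 1) i : ℝ) *
      (bernoulli i : ℝ) * D ^ (2 * (m + 1) + 1 - i) / (2 * ((m : ℝ) + 1) + 1) = S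
  rw [show D ^ (2 * (m + 1) + 1) = (D ^ m) ^ 2 * D ^ 3 by ring,
    show D ^ (2 * (m + 1)) = (D ^ m) ^ 2 * D ^ 2 by ring,
    show D ^ (3 * (m + 1)) = (D ^ m) ^ 3 * D ^ 3 by ring, div_pow, one_div_pow,
    show D ^ (m + 1) = D ^ m * D by ring]
  field_simp
  ring

/-- The polynomial in `ε` that represents the exponent up to order `K`. -/
def exponentPoly (K : ℕ) : ℚ[X][X] :=
  ∑ m ∈ range (K + 1), ((if m = 0 then 0 else
      monomial m (monomial (m + 1) ((-1 : ℚ) ^ (m + 1) / (2 * (m : ℚ) + 3)))) +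
    ∑ i ∈ Icc 2 (2 * (m + 1)), monomial (m + i) (monomial (m + 1) (bernoulliTerm i (m + 1))))

lemma coeff_exponentPoly {k K : ℕ} (hk : k < K) :
    (exponentPoly K).coeff k = PowerSeries.coeff k exponentSeries := by
  rw [exponentPoly, finsetSum_coeff, exponentSeries, PowerSeries.coeff_mk]
  simp only [coeff_add]
  rw [sum_add_distrib]
  have h1 : ∑ m ∈ range (K + 1), (if m = 0 then (0 : ℚ[X][X]) else
      monomial m (monomial (m + 1) ((-1 : ℚ) ^ (m + 1) / (2 * (m : ℚ) + 3)))).coeff k =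
      if k = 0 then 0 else monomial (k + 1) ((-1 : ℚ) ^ (k + 1) / (2 * (k : ℚ) + 3)) := by
    rw [sum_eq_single k]
    · split_ifs with h
      · rw [coeff_zero]
      · rw [coeff_monomial_same]
    · intro m _ hm
      split_ifs with h
      · rw [coeff_zero]
      · rw [coeff_monomial_of_ne _ hm.symm]
    · intro h
      exact absurd (mem_range.2 (by omega)) h
  have h2 : ∑ m ∈ range (K + 1), (∑ i ∈ Icc 2 (2 * (m + 1)),
        (monomial (m + i) (monomial (m + 1) (bernoulliTerm i (m + 1))) : ℚ[X][X])).coeff k =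
      ∑ p ∈ (HasAntidiagonal.antidiagonal (k + 1)).filter (fun p => 2 ≤ p.1 ∧ p.1 ≤ 2 * p.2),
        monomial p.2 (bernoulliTerm p.1 p.2) := by
    simp only [finsetSum_coeff, coeff_monomial]
    rw [sum_sigma', ← sum_filter]
    refine sum_nbij' (fun x => (x.2, x.1 + 1)) (fun p => ⟨p.2 - 1, p.1⟩) ?_ ?_ ?_ ?_ ?_
    · rintro ⟨m, i⟩ h
      simp only [mem_filter, mem_sigma, mem_range, mem_Icc,
        HasAntidiagonal.mem_antidiagonal] at h ⊢
      omega
    · rintro ⟨i, j⟩ h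
      simp only [mem_filter, mem_sigma, mem_range, mem_Icc,
        HasAntidiagonal.mem_antidiagonal] at h ⊢
      omega
    · rintro ⟨m, i⟩ h
      simp
    · rintro ⟨i, j⟩ h
      simp only [mem_filter, HasAntidiagonal.mem_antidiagonal] at h
      ext <;> simp
      omega
    · rintro ⟨m, i⟩ h
      rfl
  rw [h1, h2]
  split_ifs with h
  · subst h
    rw [zero_add]
    apply sum_eq_zero
    rintro ⟨i, j⟩ h
    simp only [mem_filter, HasAntidiagonal.mem_antidiagonal] at h
    omega
  · rfl

lemma evp_exponentPoly (K : ℕ) {a : ℕ × ℝ} (ha : a ∈ laplaceScale.carrier) :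
    laplaceScale.evp (exponentPoly K) a = a.2 / 3 +
      ∑ l ∈ range a.1, logTaylor (K + 1) ((2 * (l : ℝ) + 1) ^ 2 / (2 * (a.1 : ℝ) - 1) ^ 2 *
        (a.2 / (2 * (a.1 : ℝ) - 1))) - a.1 * logTaylor (K + 1) (a.2 / (2 * (a.1 : ℝ) - 1)) := by
  obtain ⟨N, y⟩ := a
  have hN : 3 ≤ N := ha.1
  simp only [logTaylor]
  rw [sum_comm, mul_sum, add_sub_assoc, ← sum_sub_distrib]
  have h1 : ∀ m ∈ range (K + 1), (∑ l ∈ range N, (-1) ^ m * ((2 * (l : ℝ) + 1) ^ 2 /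
      (2 * (N : ℝ) - 1) ^ 2 * (y / (2 * (N : ℝ) - 1))) ^ (m + 1) / ((m : ℝ) + 1)) -
      N * ((-1) ^ m * (y / (2 * (N : ℝ) - 1)) ^ (m + 1) / ((m : ℝ) + 1)) =
      (-1) ^ (m + 1) / (2 * (m : ℝ) + 3) * y ^ (m + 1) * (1 / (2 * (N : ℝ) - 1)) ^ m +
      ∑ i ∈ Icc 2 (2 * (m + 1)),
        (bernoulliTerm i (m + 1) : ℝ) * y ^ (m + 1) * (1 / (2 * (N : ℝ) - 1)) ^ (m + i) := by
    intro m _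
    rw [← sum_odd_pow_div N hN, mul_sub, mul_sum]
    congr 1
    · exact sum_congr rfl fun l _ => by ring
    · ring
  rw [sum_congr rfl h1, exponentPoly, Scale.evp, eval₂_finsetSum, sum_range_succ', sum_range_succ']
  have h2 : ∀ m, (if m = 0 then (0 : ℚ[X][X]) else
      monomial m (monomial (m + 1) ((-1 : ℚ) ^ (m + 1) / (2 * (m : ℚ) + 3)))).eval₂
        (laplaceScale.ev (N, y)) (laplaceScale.eps (N, y)) = if m = 0 then 0 else
      (-1) ^ (m + 1) / (2 * (m : ℝ) + 3) * y ^ (m + 1) * (1 / (2 * (N : ℝ) - 1)) ^ m := by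
    intro m
    split_ifs
    · simp
    · simp [eval₂_monomial, laplaceScale, aeval_monomial]
  have h3 : ∀ m, (∑ i ∈ Icc 2 (2 * (m + 1)),
      (monomial (m + i) (monomial (m + 1) (bernoulliTerm i (m + 1))) : ℚ[X][X])).eval₂
        (laplaceScale.ev (N, y)) (laplaceScale.eps (N, y)) = ∑ i ∈ Icc 2 (2 * (m + 1)),
        (bernoulliTerm i (m + 1) : ℝ) * y ^ (m + 1) * (1 / (2 * (N : ℝ) - 1)) ^ (m + i) := by
    intro m
    rw [eval₂_finsetSum]
    refine sum_congr rfl fun i _ => ?_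
    simp [eval₂_monomial, laplaceScale, aeval_monomial]
  simp only [eval₂_add, h2, h3]
  simp only [if_true, Nat.succ_ne_zero, if_false, eval₂_zero]
  push_cast
  ring

/-! ### The expansion of the integrand -/

lemma five_le_of_mem {a : ℕ × ℝ} (ha : a ∈ laplaceScale.carrier) : 5 ≤ 2 * (a.1 : ℝ) - 1 := by
  have : (3 : ℝ) ≤ a.1 := by exact_mod_cast ha.1
  linarith

lemma div_mem_Icc {a : ℕ × ℝ} (ha : a ∈ laplaceScale.carrier) :
    0 ≤ a.2 / (2 * (a.1 : ℝ) - 1) ∧ a.2 / (2 * (a.1 : ℝ) - 1) ≤ 1 / 2 := by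
  have hD := five_le_of_mem ha
  refine ⟨div_nonneg ha.2.1 (by linarith), ?_⟩
  rw [div_le_iff₀ (by linarith)]
  have := ha.2.2
  nlinarith [ha.2.1]

lemma sq_ratio_mem_Icc {N l : ℕ} (h : l < N) :
    0 ≤ (2 * (l : ℝ) + 1) ^ 2 / (2 * (N : ℝ) - 1) ^ 2 ∧
      (2 * (l : ℝ) + 1) ^ 2 / (2 * (N : ℝ) - 1) ^ 2 ≤ 1 := by
  have hl : (l : ℝ) + 1 ≤ N := by exact_mod_cast h
  have h0 : (0 : ℝ) ≤ l := Nat.cast_nonneg l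
  refine ⟨by positivity, ?_⟩
  rw [div_le_one (by apply pow_pos; linarith)]
  gcongr
  linarith

/-- The error of the Taylor approximation of the exponent. -/
lemma abs_logRatio_sub_le (K : ℕ) {a : ℕ × ℝ} (ha : a ∈ laplaceScale.carrier) :
    |logRatio a - laplaceScale.evp (exponentPoly K) a| ≤
      4 * a.1 * (a.2 / (2 * (a.1 : ℝ) - 1)) ^ (K + 2) := by
  rw [evp_exponentPoly K ha, logRatio]
  obtain ⟨hu0, hu1⟩ := div_mem_Icc ha
  set u := a.2 / (2 * (a.1 : ℝ) - 1)
  have h1 : |Real.log (1 + u) - logTaylor (K + 1) u| ≤ 2 * u ^ (K + 2) := by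
    have := abs_log_one_add_sub_le (x := u) (by rwa [abs_of_nonneg hu0]) (K + 1)
    rwa [abs_of_nonneg hu0] at this
  have h2 : ∀ l ∈ range a.1, |Real.log (1 + (2 * (l : ℝ) + 1) ^ 2 / (2 * (a.1 : ℝ) - 1) ^ 2 * u) -
      logTaylor (K + 1) ((2 * (l : ℝ) + 1) ^ 2 / (2 * (a.1 : ℝ) - 1) ^ 2 * u)| ≤
      2 * u ^ (K + 2) := by
    intro l hl
    obtain ⟨hr0, hr1⟩ := sq_ratio_mem_Icc (mem_range.1 hl)
    set r := (2 * (l : ℝ) + 1) ^ 2 / (2 * (a.1 : ℝ) - 1) ^ 2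
    have hru0 : 0 ≤ r * u := mul_nonneg hr0 hu0
    have hru : r * u ≤ u := by nlinarith
    have := abs_log_one_add_sub_le (x := r * u) (by rw [abs_of_nonneg hru0]; linarith) (K + 1)
    rw [abs_of_nonneg hru0] at this
    exact this.trans (by gcongr)
  have h3 := (abs_sum_le_sum_abs _ _).trans (sum_le_sum h2)
  rw [sum_sub_distrib, sum_const, card_range, nsmul_eq_mul] at h3
  have h4 : |(a.1 : ℝ) * (Real.log (1 + u) - logTaylor (K + 1) u)| ≤ a.1 * (2 * u ^ (K + 2)) := by
    rw [abs_mul, abs_of_nonneg (Nat.cast_nonneg _)]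
    gcongr
  have h5 := (abs_sub _ _).trans (add_le_add h3 h4)
  refine le_trans (le_of_eq ?_) (h5.trans (le_of_eq ?_))
  · congr 1; ring
  · ring

/-- `u ^ (K + 2) * N` is small of order `K + 1`, as `N ≤ D = 1 / ε` and `u = ε y`. -/
lemma hasExp_logRatio : laplaceScale.HasExp logRatio exponentSeries := by
  intro K
  refine ⟨exponentPoly K, fun k hk => coeff_exponentPoly hk, 4, K + 2, by norm_num,
    fun a ha => (abs_logRatio_sub_le K ha).trans ?_⟩
  have hD := five_le_of_mem ha
  have hN : (a.1 : ℝ) ≤ 2 * (a.1 : ℝ) - 1 := by linarith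
  change _ ≤ 4 * (1 + |a.2|) ^ (K + 2) * (1 / (2 * (a.1 : ℝ) - 1)) ^ K
  have hy := ha.2.1
  set D := 2 * (a.1 : ℝ) - 1
  have h1 : a.2 ^ (K + 2) ≤ (1 + |a.2|) ^ (K + 2) := by
    gcongr
    linarith [le_abs_self a.2]
  have hD0 : 0 < D := by linarith
  calc 4 * (a.1 : ℝ) * (a.2 / D) ^ (K + 2) ≤ 4 * D * (a.2 / D) ^ (K + 2) := by gcongr
    _ = 4 * a.2 ^ (K + 2) * (1 / D) ^ (K + 1) := by
      rw [div_pow, one_div_pow, pow_succ D (K + 1)]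
      field_simp
    _ ≤ 4 * (1 + |a.2|) ^ (K + 2) * (1 / D) ^ (K + 1) := by gcongr
    _ ≤ 4 * (1 + |a.2|) ^ (K + 2) * (1 / D) ^ K := by
      gcongr 4 * (1 + |a.2|) ^ (K + 2) * ?_
      exact pow_le_pow_of_le_one (by positivity) (by rw [div_le_one hD0]; linarith) (by omega)

/-- The exponent is bounded in the range `y ≤ √D`. -/
lemma abs_logRatio_le {a : ℕ × ℝ} (ha : a ∈ laplaceScale.carrier) : |logRatio a| ≤ 5 := by
  have h := abs_logRatio_sub_le 0 ha
  have e : laplaceScale.evp (exponentPoly 0) a =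
      1 / 3 * a.2 * (1 / (2 * (a.1 : ℝ) - 1)) ^ 2 := by
    rw [exponentPoly, Scale.evp]
    simp [eval₂_monomial, laplaceScale, aeval_monomial, bernoulliTerm, bernoulli_two]
    norm_num
  rw [e] at h
  have hD := five_le_of_mem ha
  have hy := ha.2.1
  have hy2 := ha.2.2
  have hN : (a.1 : ℝ) ≤ 2 * (a.1 : ℝ) - 1 := by linarith
  set D := 2 * (a.1 : ℝ) - 1
  have hD0 : 0 < D := by linarith
  have h1 : 4 * (a.1 : ℝ) * (a.2 / D) ^ (0 + 2) ≤ 4 := by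
    rw [zero_add, div_pow, mul_div_assoc', div_le_iff₀ (by positivity)]
    have : (a.1 : ℝ) * a.2 ^ 2 ≤ D * D := by gcongr
    nlinarith
  have h2 : |1 / 3 * a.2 * (1 / D) ^ 2| ≤ 1 := by
    rw [abs_of_nonneg (by positivity), one_div_pow, mul_one_div, div_le_one (by positivity)]
    have : a.2 ≤ D := by nlinarith [sq_nonneg (a.2 - 1)]
    nlinarith
  have := abs_add_le (logRatio a - 1 / 3 * a.2 * (1 / D) ^ 2) (1 / 3 * a.2 * (1 / D) ^ 2)
  rw [sub_add_cancel] at this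
  linarith

lemma abs_exp_sub_sum_le (x : ℝ) (K : ℕ) :
    |Real.exp x - ∑ j ∈ range K, ((1 / (j ! : ℚ) : ℚ) : ℝ) * x ^ j| ≤
      |x| ^ K * Real.exp |x| := by
  have h := Complex.norm_exp_sub_sum_le_norm_mul_exp (x : ℂ) K
  rw [Complex.norm_real, Real.norm_eq_abs] at h
  refine le_trans (le_of_eq ?_) h
  rw [← Real.norm_eq_abs, ← Complex.norm_real]
  congr 1
  push_cast
  congr 1
  exact sum_congr rfl fun j _ => by ring

lemma coeff_zero_exponentSeries : PowerSeries.coeff 0 exponentSeries = 0 := by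
  simp [exponentSeries]

/-- The formal exponential of the exponent. -/
def expSeries : PowerSeries ℚ[X] := Scale.compSeries (fun j => 1 / (j ! : ℚ)) exponentSeries

lemma coeff_expSeries (k : ℕ) : PowerSeries.coeff k expSeries = expCoeff k := by
  rw [expSeries, Scale.compSeries, PowerSeries.coeff_mk, expCoeff]

lemma hasExp_exp_logRatio : laplaceScale.HasExp (fun a => Real.exp (logRatio a)) expSeries := by
  refine hasExp_logRatio.comp coeff_zero_exponentSeries fun K => ⟨Real.exp 5, by positivity,
    fun a ha => (abs_exp_sub_sum_le _ K).trans ?_⟩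
  rw [mul_comm]
  gcongr
  exact abs_logRatio_le ha

/-- The expansion of `1 / (1 + ε y)`. -/
lemma hasExp_inv : laplaceScale.HasExp (fun a => (1 + a.2 / (2 * (a.1 : ℝ) - 1))⁻¹)
    (PowerSeries.mk fun k => monomial k ((-1 : ℚ) ^ k)) := by
  refine Scale.hasExp_of_small_sub_sum fun K => ⟨1, K, zero_le_one, fun a ha => ?_⟩
  obtain ⟨hu0, hu1⟩ := div_mem_Icc ha
  have hy := ha.2.1
  have hD := five_le_of_mem ha
  have e : ∑ k ∈ range K, laplaceScale.ev a (PowerSeries.coeff k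
      (PowerSeries.mk fun k => monomial k ((-1 : ℚ) ^ k))) * laplaceScale.eps a ^ k =
      ∑ k ∈ range K, (-(a.2 / (2 * (a.1 : ℝ) - 1))) ^ k := by
    refine sum_congr rfl fun k _ => ?_
    simp only [PowerSeries.coeff_mk, laplaceScale, AlgHom.toRingHom_eq_coe, RingHom.coe_coe,
      aeval_monomial, map_pow, map_neg, map_one]
    rw [neg_pow (a.2 / _), div_pow, div_pow, one_pow]
    ring
  beta_reduce
  rw [e]
  change _ ≤ 1 * (1 + |a.2|) ^ K * (1 / (2 * (a.1 : ℝ) - 1)) ^ K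
  have hg := mul_neg_geom_sum (-(a.2 / (2 * (a.1 : ℝ) - 1))) K
  have e2 : a.2 / (2 * (a.1 : ℝ) - 1) = a.2 * (1 / (2 * (a.1 : ℝ) - 1)) := by ring
  have e3 : (0 : ℝ) ≤ 1 / (2 * (a.1 : ℝ) - 1) := by apply one_div_nonneg.2; linarith
  set u := a.2 / (2 * (a.1 : ℝ) - 1)
  have hu : 1 + u ≠ 0 := by linarith
  rw [sub_neg_eq_add] at hg
  have : (1 + u)⁻¹ - ∑ k ∈ range K, (-u) ^ k = (-u) ^ K * (1 + u)⁻¹ := by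
    field_simp
    linarith
  rw [this, abs_mul, abs_pow, abs_neg, abs_of_nonneg hu0, abs_of_nonneg (by positivity), one_mul,
    ← mul_pow]
  have h1 : (1 + u)⁻¹ ≤ 1 := inv_le_one_of_one_le₀ (by linarith)
  refine (mul_le_of_le_one_right (by positivity) h1).trans ?_
  rw [e2]
  gcongr
  linarith [le_abs_self a.2]

/-- The ratio of the integrand to the Gaussian weight. -/
def laplaceRatio (a : ℕ × ℝ) : ℝ :=
  (1 + a.2 / (2 * (a.1 : ℝ) - 1))⁻¹ ^ 2 * Real.exp (logRatio a)

/-- The formal expansion of `laplaceRatio`. -/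
def ratioSeries : PowerSeries ℚ[X] :=
  (PowerSeries.mk fun k => monomial k ((-1 : ℚ) ^ k)) ^ 2 * expSeries

lemma hasExp_laplaceRatio : laplaceScale.HasExp laplaceRatio ratioSeries :=
  (hasExp_inv.pow 2).mul hasExp_exp_logRatio

lemma X_mul_coeff_ratioSeries (k : ℕ) : X * PowerSeries.coeff k ratioSeries =
    ∑ p ∈ HasAntidiagonal.antidiagonal k,
      monomial (p.1 + 1) ((-1 : ℚ) ^ p.1 * ((p.1 : ℚ) + 1)) * expCoeff p.2 := by
  rw [ratioSeries, PowerSeries.coeff_mul, mul_sum]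
  refine sum_congr rfl fun p _ => ?_
  rw [coeff_expSeries, ← mul_assoc]
  congr 1
  rw [sq, PowerSeries.coeff_mul]
  simp only [PowerSeries.coeff_mk, monomial_mul_monomial]
  have : ∀ x ∈ HasAntidiagonal.antidiagonal p.1,
      (monomial (x.1 + x.2) ((-1 : ℚ) ^ x.1 * (-1) ^ x.2) : ℚ[X]) = monomial p.1 ((-1) ^ p.1) := by
    intro x hx
    rw [← pow_add, HasAntidiagonal.mem_antidiagonal.1 hx]
  rw [sum_congr rfl this, sum_const, Finset.Nat.card_antidiagonal, smul_monomial, X_mul_monomial,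
    nsmul_eq_mul, mul_comm]
  push_cast
  rfl

/-! ### Gaussian moments and the main part of the integral -/

/-- The moments of the Gaussian weight are the values of `momentFunctional` on powers, up to the
normalization. -/
lemma integral_pow_mul_gaussian (m : ℕ) :
    ∫ s in Set.Ioi (0 : ℝ), s ^ (2 * m) * Real.exp (-(1 / 3) * s ^ 2) =
      Real.sqrt (27 * Real.pi) / 4 *
        (2 / 3 * (((2 * m)! : ℝ) / (m ! : ℝ)) * (3 / 4) ^ m) := by
  have h := integral_rpow_mul_exp_neg_mul_rpow (p := 2) (q := 2 * m) (b := 1 / 3) two_pos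
    (by have : (0 : ℝ) ≤ m := Nat.cast_nonneg m; linarith) (by norm_num)
  have e : ∫ s in Set.Ioi (0 : ℝ), s ^ (2 * m) * Real.exp (-(1 / 3) * s ^ 2) =
      ∫ s in Set.Ioi (0 : ℝ), s ^ (2 * (m : ℝ)) * Real.exp (-(1 / 3) * s ^ (2 : ℝ)) := by
    refine MeasureTheory.setIntegral_congr_fun measurableSet_Ioi fun s _ => ?_
    rw [Real.rpow_two, ← Real.rpow_natCast s (2 * m)]
    push_cast
    rfl
  rw [e, h]
  clear e h
  induction m with
  | zero =>
    have h3 : (1 / 3 : ℝ) ^ (-(2 * ((0 : ℕ) : ℝ) + 1) / 2) = Real.sqrt 3 := by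
      rw [Real.sqrt_eq_rpow, one_div, Real.inv_rpow (by norm_num), ← Real.rpow_neg (by norm_num)]
      norm_num
    rw [h3, show (2 * ((0 : ℕ) : ℝ) + 1) / 2 = 1 / 2 by norm_num, Real.Gamma_one_half_eq,
      Real.sqrt_mul (by norm_num), show (27 : ℝ) = 3 ^ 2 * 3 by norm_num,
      Real.sqrt_mul (by norm_num), Real.sqrt_sq (by norm_num)]
    simp
    ring
  | succ m ih =>
    have e1 : (2 * ((m + 1 : ℕ) : ℝ) + 1) / 2 = (2 * (m : ℝ) + 1) / 2 + 1 := by push_cast; ring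
    have e2 : -(2 * ((m + 1 : ℕ) : ℝ) + 1) / 2 = -(2 * (m : ℝ) + 1) / 2 + (-1) := by
      push_cast; ring
    rw [e1, Real.Gamma_add_one (by positivity), e2, Real.rpow_add (by norm_num),
      Real.rpow_neg_one]
    have e3 : ((2 * (m + 1))! : ℝ) = (2 * m + 2) * (2 * m + 1) * ((2 * m)! : ℝ) := by
      rw [show 2 * (m + 1) = 2 * m + 1 + 1 by ring, Nat.factorial_succ, Nat.factorial_succ]
      push_cast
      ring
    have e4 : ((m + 1)! : ℝ) = (m + 1) * (m ! : ℝ) := by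
      rw [Nat.factorial_succ]; push_cast; ring
    have hm : (m ! : ℝ) ≠ 0 := by positivity
    rw [e3, e4, pow_succ]
    calc _ = (3 * (2 * (m : ℝ) + 1) / 2) * ((1 / 3) ^ (-(2 * (m : ℝ) + 1) / 2) * (1 / 2) *
          Real.Gamma ((2 * m + 1) / 2)) := by field_simp
      _ = _ := by
        rw [ih]
        field_simp
        ring

lemma integrableOn_pow_mul_gaussian (m : ℕ) :
    MeasureTheory.IntegrableOn (fun s : ℝ => s ^ (2 * m) * Real.exp (-(1 / 3) * s ^ 2))
      (Set.Ioi 0) := by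
  have h := integrableOn_rpow_mul_exp_neg_mul_sq (b := 1 / 3) (by norm_num) (s := 2 * m)
    (by have : (0 : ℝ) ≤ m := Nat.cast_nonneg m; linarith)
  refine h.congr_fun (fun s _ => ?_) measurableSet_Ioi
  beta_reduce
  rw [← Real.rpow_natCast s (2 * m)]
  push_cast
  rfl

lemma aeval_mul_gaussian_eq_sum (p : ℚ[X]) (s : ℝ) :
    aeval (s ^ 2) p * Real.exp (-(1 / 3) * s ^ 2) =
      ∑ m ∈ p.support, (p.coeff m : ℝ) * (s ^ (2 * m) * Real.exp (-(1 / 3) * s ^ 2)) := by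
  rw [aeval_def, eval₂_eq_sum, Polynomial.sum, sum_mul]
  refine sum_congr rfl fun m _ => ?_
  rw [eq_ratCast, pow_mul]
  ring

lemma integrableOn_aeval_mul_gaussian (p : ℚ[X]) :
    MeasureTheory.IntegrableOn (fun s : ℝ => aeval (s ^ 2) p * Real.exp (-(1 / 3) * s ^ 2))
      (Set.Ioi 0) := by
  simp_rw [aeval_mul_gaussian_eq_sum]
  exact MeasureTheory.integrable_finsetSum _ fun m _ =>
    (integrableOn_pow_mul_gaussian m).const_mul _

lemma integral_aeval_mul_gaussian (p : ℚ[X]) :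
    ∫ s in Set.Ioi (0 : ℝ), aeval (s ^ 2) p * Real.exp (-(1 / 3) * s ^ 2) =
      Real.sqrt (27 * Real.pi) / 4 * (momentFunctional p : ℝ) := by
  simp_rw [aeval_mul_gaussian_eq_sum]
  rw [MeasureTheory.integral_finsetSum _ fun m _ =>
    (integrableOn_pow_mul_gaussian m).const_mul _]
  simp_rw [MeasureTheory.integral_const_mul, integral_pow_mul_gaussian]
  rw [momentFunctional, Polynomial.sum]
  push_cast
  rw [mul_sum]
  exact sum_congr rfl fun m _ => by ring

/-- The cut-off integrand of the Laplace method stays close to its expansion on the whole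
half-line: beyond the cut-off `s ^ 4 = D` the factor `1 ≤ (s ^ 4 / D) ^ K` may be inserted. -/
lemma exists_abs_indicator_laplaceRatio_sub_le (K : ℕ) : ∃ (C : ℝ) (M : ℕ), 0 ≤ C ∧
    ∀ N : ℕ, 3 ≤ N → ∀ c : ℝ, 0 < c → c ^ 4 = 2 * N - 1 → ∀ s : ℝ, 0 < s →
      |(Set.Iic c).indicator (fun s => laplaceRatio (N, s ^ 2)) s -
        ∑ k ∈ range K, aeval (s ^ 2) (PowerSeries.coeff k ratioSeries) *
          (1 / (2 * (N : ℝ) - 1)) ^ k| ≤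
        C * (1 + s ^ 2) ^ M * (1 / (2 * (N : ℝ) - 1)) ^ K := by
  obtain ⟨C₁, M₁, hC₁, h₁⟩ := hasExp_laplaceRatio.small_sub_sum K
  have h₂ : ∃ (C : ℝ) (M : ℕ), 0 ≤ C ∧ ∀ y : ℝ,
      ∑ k ∈ range K, |aeval y (PowerSeries.coeff k ratioSeries)| ≤ C * (1 + |y|) ^ M := by
    choose C M hC hM using fun k => exists_abs_aeval_le (PowerSeries.coeff k ratioSeries)
    refine ⟨∑ k ∈ range K, C k, ∑ k ∈ range K, M k, sum_nonneg fun k _ => hC k, fun y => ?_⟩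
    rw [sum_mul]
    refine sum_le_sum fun k hk => (hM k y).trans ?_
    have h1 : 1 ≤ 1 + |y| := by linarith [abs_nonneg y]
    have := pow_le_pow_right₀ h1 (single_le_sum (fun i _ => Nat.zero_le (M i)) hk)
    have := hC k
    gcongr
  obtain ⟨C₂, M₂, hC₂, h₂⟩ := h₂
  refine ⟨C₁ + C₂, M₁ + (M₂ + 2 * K), add_nonneg hC₁ hC₂, fun N hN c hc hcD s hs => ?_⟩
  have hN' : (3 : ℝ) ≤ N := by exact_mod_cast hN
  set D : ℝ := 2 * N - 1 with hD
  have hD0 : 1 ≤ D := by linarith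
  have hw : 1 ≤ 1 + s ^ 2 := by nlinarith
  have he0 : 0 ≤ 1 / D := by positivity
  have he1 : 1 / D ≤ 1 := by rw [div_le_one (by linarith)]; exact hD0
  have habs : |s ^ 2| = s ^ 2 := abs_of_nonneg (by positivity)
  by_cases hsc : s ≤ c
  · rw [Set.indicator_of_mem (show s ∈ Set.Iic c from hsc)]
    have hmem : ((N, s ^ 2) : ℕ × ℝ) ∈ laplaceScale.carrier := by
      refine ⟨hN, by positivity, ?_⟩
      simp only
      rw [← pow_mul, ← hD, ← hcD]
      gcongr
    refine (h₁ (N, s ^ 2) hmem).trans ?_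
    change C₁ * (1 + |s ^ 2|) ^ M₁ * (1 / D) ^ K ≤ _
    rw [habs]
    have := pow_le_pow_right₀ hw (show M₁ ≤ M₁ + (M₂ + 2 * K) by omega)
    gcongr
    linarith
  · rw [Set.indicator_of_notMem (show s ∉ Set.Iic c from hsc), zero_sub, abs_neg]
    have hDs : D ≤ (1 + s ^ 2) ^ 2 := by
      rw [← hcD]
      have : c ^ 4 ≤ s ^ 4 := by
        have := (not_le.1 hsc).le
        gcongr
      nlinarith
    have hK : 1 ≤ (1 + s ^ 2) ^ (2 * K) * (1 / D) ^ K := by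
      rw [pow_mul, ← mul_pow]
      apply one_le_pow₀
      rw [mul_one_div, le_div_iff₀ (by linarith)]
      linarith
    calc |∑ k ∈ range K, aeval (s ^ 2) (PowerSeries.coeff k ratioSeries) * (1 / D) ^ k|
        ≤ ∑ k ∈ range K, |aeval (s ^ 2) (PowerSeries.coeff k ratioSeries)| := by
          refine (abs_sum_le_sum_abs _ _).trans (sum_le_sum fun k _ => ?_)
          rw [abs_mul, abs_of_nonneg (pow_nonneg he0 k)]
          exact mul_le_of_le_one_right (abs_nonneg _) (pow_le_one₀ he0 he1)
      _ ≤ C₂ * (1 + s ^ 2) ^ M₂ := by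
          have := h₂ (s ^ 2)
          rwa [habs] at this
      _ ≤ C₂ * (1 + s ^ 2) ^ M₂ * ((1 + s ^ 2) ^ (2 * K) * (1 / D) ^ K) :=
          le_mul_of_one_le_right (by positivity) hK
      _ = C₂ * (1 + s ^ 2) ^ (M₂ + 2 * K) * (1 / D) ^ K := by rw [pow_add]; ring
      _ ≤ _ := by
        have := pow_le_pow_right₀ hw (show M₂ + 2 * K ≤ M₁ + (M₂ + 2 * K) by omega)
        gcongr
        linarith

lemma continuous_laplaceRatio {N : ℕ} (hN : 3 ≤ N) :
    Continuous (fun s : ℝ => laplaceRatio (N, s ^ 2)) := by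
  have hN' : (3 : ℝ) ≤ N := by exact_mod_cast hN
  have hD : 0 < 2 * (N : ℝ) - 1 := by linarith
  unfold laplaceRatio logRatio
  simp only
  have h1 : ∀ s : ℝ, 1 + s ^ 2 / (2 * (N : ℝ) - 1) ≠ 0 := fun s => by positivity
  have h2 : ∀ (l : ℕ) (s : ℝ), 1 + (2 * (l : ℝ) + 1) ^ 2 / (2 * (N : ℝ) - 1) ^ 2 *
      (s ^ 2 / (2 * (N : ℝ) - 1)) ≠ 0 := fun l s => by positivity
  refine ((Continuous.inv₀ (by fun_prop) h1).pow 2).mul (Real.continuous_exp.comp ?_)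
  refine Continuous.sub (Continuous.add (by fun_prop) (continuous_finsetSum _ fun l _ => ?_)) ?_
  · exact Continuous.log (by fun_prop) (h2 l)
  · exact continuous_const.mul (Continuous.log (by fun_prop) h1)

/-- The expansion of the main part of the Laplace integral. -/
lemma exists_abs_integral_laplaceRatio_sub_le (K : ℕ) : ∃ C : ℝ, 0 ≤ C ∧
    ∀ N : ℕ, 3 ≤ N → ∀ c : ℝ, 0 < c → c ^ 4 = 2 * N - 1 →
      |(∫ s in (0 : ℝ)..c, s ^ 2 * Real.exp (-(1 / 3) * s ^ 2) * laplaceRatio (N, s ^ 2)) -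
        Real.sqrt (27 * Real.pi) / 4 *
          ∑ k ∈ range K, (degreeCoeff k : ℝ) * (1 / (2 * (N : ℝ) - 1)) ^ k| ≤
        C * (1 / (2 * (N : ℝ) - 1)) ^ K := by
  obtain ⟨C, M, hC, h⟩ := exists_abs_indicator_laplaceRatio_sub_le K
  set B : ℝ := ∫ s in Set.Ioi (0 : ℝ), aeval (s ^ 2) (X * (1 + X) ^ M : ℚ[X]) *
    Real.exp (-(1 / 3) * s ^ 2) with hB
  have hB0 : 0 ≤ B := MeasureTheory.setIntegral_nonneg measurableSet_Ioi fun s _ => by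
    simp only [map_mul, map_pow, map_add, map_one, aeval_X]
    positivity
  refine ⟨C * B, mul_nonneg hC hB0, fun N hN c hc hcD => ?_⟩
  set e : ℝ := 1 / (2 * (N : ℝ) - 1) with he
  have ind : (fun s : ℝ => s ^ 2 * Real.exp (-(1 / 3) * s ^ 2) *
        (Set.Iic c).indicator (fun s => laplaceRatio (N, s ^ 2)) s) = (Set.Iic c).indicator
        (fun s => s ^ 2 * Real.exp (-(1 / 3) * s ^ 2) * laplaceRatio (N, s ^ 2)) :=
    funext fun s => (Set.indicator_mul_right (Set.Iic c)
      (fun s : ℝ => s ^ 2 * Real.exp (-(1 / 3) * s ^ 2)) (fun s => laplaceRatio (N, s ^ 2))).symm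
  have e1 : ∫ s in (0 : ℝ)..c, s ^ 2 * Real.exp (-(1 / 3) * s ^ 2) * laplaceRatio (N, s ^ 2) =
      ∫ s in Set.Ioi (0 : ℝ), s ^ 2 * Real.exp (-(1 / 3) * s ^ 2) *
        (Set.Iic c).indicator (fun s => laplaceRatio (N, s ^ 2)) s := by
    rw [intervalIntegral.integral_of_le hc.le, ← Set.Ioi_inter_Iic, ind,
      MeasureTheory.setIntegral_indicator measurableSet_Iic]
  have i1 : MeasureTheory.IntegrableOn (fun s => s ^ 2 * Real.exp (-(1 / 3) * s ^ 2) *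
        (Set.Iic c).indicator (fun s => laplaceRatio (N, s ^ 2)) s) (Set.Ioi 0) := by
    rw [ind, MeasureTheory.IntegrableOn, MeasureTheory.integrable_indicator_iff measurableSet_Iic,
      MeasureTheory.IntegrableOn, MeasureTheory.Measure.restrict_restrict measurableSet_Iic,
      Set.inter_comm, Set.Ioi_inter_Iic]
    exact ((by fun_prop : Continuous fun s : ℝ => s ^ 2 * Real.exp (-(1 / 3) * s ^ 2)).mul
      (continuous_laplaceRatio hN)).integrableOn_Ioc
  have e2 : Real.sqrt (27 * Real.pi) / 4 * ∑ k ∈ range K, (degreeCoeff k : ℝ) * e ^ k =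
      ∫ s in Set.Ioi (0 : ℝ), ∑ k ∈ range K, e ^ k *
        (aeval (s ^ 2) (X * PowerSeries.coeff k ratioSeries) * Real.exp (-(1 / 3) * s ^ 2)) := by
    rw [MeasureTheory.integral_finsetSum _ fun k _ =>
      (integrableOn_aeval_mul_gaussian _).const_mul _, mul_sum]
    refine sum_congr rfl fun k _ => ?_
    rw [MeasureTheory.integral_const_mul, integral_aeval_mul_gaussian, X_mul_coeff_ratioSeries,
      degreeCoeff]
    ring
  rw [e1, e2, ← MeasureTheory.integral_sub i1 (MeasureTheory.integrable_finsetSum _ fun k _ =>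
      (integrableOn_aeval_mul_gaussian _).const_mul _), mul_right_comm, hB,
    ← MeasureTheory.integral_const_mul, ← Real.norm_eq_abs]
  refine MeasureTheory.norm_integral_le_of_norm_le
    ((integrableOn_aeval_mul_gaussian _).const_mul _) ?_
  refine (MeasureTheory.ae_restrict_iff' measurableSet_Ioi).2 (Eventually.of_forall fun s hs => ?_)
  have hs' := h N hN c hc hcD s hs
  rw [Real.norm_eq_abs]
  have e3 : s ^ 2 * Real.exp (-(1 / 3) * s ^ 2) *
        (Set.Iic c).indicator (fun s => laplaceRatio (N, s ^ 2)) s - ∑ k ∈ range K, e ^ k *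
        (aeval (s ^ 2) (X * PowerSeries.coeff k ratioSeries) * Real.exp (-(1 / 3) * s ^ 2)) =
      s ^ 2 * Real.exp (-(1 / 3) * s ^ 2) *
        ((Set.Iic c).indicator (fun s => laplaceRatio (N, s ^ 2)) s -
        ∑ k ∈ range K, aeval (s ^ 2) (PowerSeries.coeff k ratioSeries) * e ^ k) := by
    rw [mul_sub, mul_sum]
    congr 1
    refine sum_congr rfl fun k _ => ?_
    rw [map_mul, aeval_X]
    ring
  rw [e3, abs_mul, abs_of_nonneg (by positivity)]
  refine (mul_le_mul_of_nonneg_left hs' (by positivity)).trans_eq ?_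
  simp only [map_mul, map_pow, map_add, map_one, aeval_X]
  ring

/-! ### The expansion in powers of the inverse degree -/

lemma exp_logRatio {N : ℕ} (hN : 3 ≤ N) {y : ℝ} (hy : 0 ≤ y) :
    Real.exp (logRatio (N, y)) = Real.exp (y / 3) *
      (∏ l ∈ range N, (1 + (2 * (l : ℝ) + 1) ^ 2 / (2 * (N : ℝ) - 1) ^ 2 *
        (y / (2 * (N : ℝ) - 1)))) / (1 + y / (2 * (N : ℝ) - 1)) ^ N := by
  have hN' : (3 : ℝ) ≤ N := by exact_mod_cast hN
  have hD : 0 < 2 * (N : ℝ) - 1 := by linarith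
  rw [logRatio, Real.exp_sub, Real.exp_add, Real.exp_sum, Real.exp_nat_mul,
    Real.exp_log (by positivity)]
  congr 2
  exact prod_congr rfl fun l _ => Real.exp_log (by positivity)

/-- The integrand under the substitution `tan θ = s / √D`, with `c = D ^ (1 / 4)`. -/
lemma angularIntegrand_arctan {N : ℕ} (hN : 3 ≤ N) {c : ℝ} (hc : 0 < c)
    (hcD : c ^ 4 = 2 * N - 1) (s : ℝ) :
    angularIntegrand N (Real.arctan (s / c ^ 2)) * (1 / (1 + (s / c ^ 2) ^ 2) * (1 / c ^ 2)) =
      (2 * (N : ℝ) - 1) ^ (2 * N) / c ^ 6 *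
        (s ^ 2 * Real.exp (-(1 / 3) * s ^ 2) * laplaceRatio (N, s ^ 2)) := by
  rw [laplaceRatio, exp_logRatio hN (by positivity), angularIntegrand, Real.sin_sq,
    Real.cos_sq_arctan]
  have hu : (s / c ^ 2) ^ 2 = s ^ 2 / (2 * (N : ℝ) - 1) := by rw [← hcD]; field_simp
  rw [hu]
  simp only
  have hD : 0 < 2 * (N : ℝ) - 1 := by rw [← hcD]; positivity
  set D := 2 * (N : ℝ) - 1 with hDdef
  set u := s ^ 2 / D with hudef
  have hu0 : 0 ≤ u := by positivity
  have e1 : ∏ l ∈ range N, (D ^ 2 * (1 / (1 + u)) + (2 * (l : ℝ) + 1) ^ 2 * (1 - 1 / (1 + u))) =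
      D ^ (2 * N) / (1 + u) ^ N * ∏ l ∈ range N, (1 + (2 * (l : ℝ) + 1) ^ 2 / D ^ 2 * u) := by
    have : ∀ l ∈ range N, D ^ 2 * (1 / (1 + u)) + (2 * (l : ℝ) + 1) ^ 2 * (1 - 1 / (1 + u)) =
        D ^ 2 / (1 + u) * (1 + (2 * (l : ℝ) + 1) ^ 2 / D ^ 2 * u) := by
      intro l _
      field_simp
      ring
    rw [prod_congr rfl this, prod_mul_distrib, prod_const, card_range, div_pow, ← pow_mul]
  rw [e1]
  have e2 : Real.exp (-(1 / 3) * s ^ 2) = (Real.exp (s ^ 2 / 3))⁻¹ := by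
    rw [← Real.exp_neg]; congr 1; ring
  have e3 : s ^ 2 = u * c ^ 4 := by rw [hudef, hcD]; field_simp
  rw [e2]
  have := Real.exp_ne_zero (s ^ 2 / 3)
  generalize Real.exp (s ^ 2 / 3) = E at *
  rw [e3]
  generalize ∏ l ∈ range N, (1 + (2 * (l : ℝ) + 1) ^ 2 / D ^ 2 * u) = P
  field_simp
  ring

lemma integral_angularIntegrand_main {N : ℕ} (hN : 3 ≤ N) {c : ℝ} (hc : 0 < c)
    (hcD : c ^ 4 = 2 * N - 1) :
    ∫ θ in (0 : ℝ)..Real.arctan (1 / c), angularIntegrand N θ =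
      (2 * (N : ℝ) - 1) ^ (2 * N) / c ^ 6 *
        ∫ s in (0 : ℝ)..c, s ^ 2 * Real.exp (-(1 / 3) * s ^ 2) * laplaceRatio (N, s ^ 2) := by
  have h := intervalIntegral.integral_comp_mul_deriv (a := 0) (b := c)
    (f := fun s => Real.arctan (s / c ^ 2))
    (f' := fun s => 1 / (1 + (s / c ^ 2) ^ 2) * (1 / c ^ 2)) (g := angularIntegrand N)
    (fun s _ => ((hasDerivAt_id s).div_const (c ^ 2)).arctan)
    (by
      refine Continuous.continuousOn (Continuous.mul (Continuous.div (by fun_prop) (by fun_prop)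
        fun s => by positivity) (by fun_prop)))
    (continuous_angularIntegrand N)
  have e : c / c ^ 2 = 1 / c := by field_simp
  simp only [Function.comp_apply, angularIntegrand_arctan hN hc hcD, zero_div, Real.arctan_zero,
    e] at h
  rw [← h, intervalIntegral.integral_const_mul]

lemma sum_one_sub_odd_sq (N : ℕ) (hN : 3 ≤ N) :
    ∑ l ∈ range N, (1 - (2 * (l : ℝ) + 1) ^ 2 / (2 * (N : ℝ) - 1) ^ 2) =
      ((2 * (N : ℝ) - 1) ^ 2 - 1) / (3 * (2 * (N : ℝ) - 1)) := by
  have hN' : (3 : ℝ) ≤ N := by exact_mod_cast hN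
  have hD : 2 * (N : ℝ) - 1 ≠ 0 := by linarith
  have h : ∀ n : ℕ, ∑ l ∈ range n, (2 * (l : ℝ) + 1) ^ 2 =
      (n : ℝ) * (2 * n - 1) * (2 * n + 1) / 3 := by
    intro n
    induction n with
    | zero => simp
    | succ n ih => rw [sum_range_succ, ih]; push_cast; ring
  rw [sum_sub_distrib, ← sum_div, h]
  simp only [sum_const, card_range, nsmul_eq_mul, mul_one]
  have hND : (N : ℝ) = ((2 * (N : ℝ) - 1) + 1) / 2 := by ring
  generalize 2 * (N : ℝ) - 1 = D at *
  rw [hND]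
  field_simp
  ring

lemma angularIntegrand_le {N : ℕ} (hN : 3 ≤ N) (θ : ℝ) :
    angularIntegrand N θ ≤ (2 * (N : ℝ) - 1) ^ (2 * N) *
      Real.exp (-(((2 * (N : ℝ) - 1) ^ 2 - 1) / (3 * (2 * (N : ℝ) - 1)) * Real.sin θ ^ 2)) := by
  have hN' : (3 : ℝ) ≤ N := by exact_mod_cast hN
  have hD : 0 < 2 * (N : ℝ) - 1 := by linarith
  rw [← sum_one_sub_odd_sq N hN]
  set D := 2 * (N : ℝ) - 1 with hDdef
  have h1 : ∏ l ∈ range N, (D ^ 2 * Real.cos θ ^ 2 + (2 * (l : ℝ) + 1) ^ 2 * Real.sin θ ^ 2) ≤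
      ∏ l ∈ range N, (D ^ 2 *
        Real.exp (-((1 - (2 * (l : ℝ) + 1) ^ 2 / D ^ 2) * Real.sin θ ^ 2))) := by
    refine prod_le_prod (fun l _ => by positivity) fun l _ => ?_
    have := Real.add_one_le_exp (-((1 - (2 * (l : ℝ) + 1) ^ 2 / D ^ 2) * Real.sin θ ^ 2))
    have e : D ^ 2 * Real.cos θ ^ 2 + (2 * (l : ℝ) + 1) ^ 2 * Real.sin θ ^ 2 =
        D ^ 2 * (-((1 - (2 * (l : ℝ) + 1) ^ 2 / D ^ 2) * Real.sin θ ^ 2) + 1) := by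
      rw [Real.cos_sq']
      field_simp
      ring
    rw [e]
    gcongr
  rw [prod_mul_distrib, prod_const, card_range, ← pow_mul, ← Real.exp_sum, sum_neg_distrib,
    ← sum_mul] at h1
  rw [angularIntegrand]
  refine le_trans (mul_le_of_le_one_left (prod_nonneg fun l _ => by positivity)
    (Real.sin_sq_le_one θ)) h1

/-- Beyond the cut-off the integral is exponentially small in `√D = c ^ 2`. -/
lemma integral_angularIntegrand_tail_le {N : ℕ} (hN : 3 ≤ N) {c : ℝ} (hc : 0 < c)
    (hcD : c ^ 4 = 2 * N - 1) :
    |∫ θ in Real.arctan (1 / c)..(Real.pi / 2), angularIntegrand N θ| ≤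
      2 * (2 * (N : ℝ) - 1) ^ (2 * N) * Real.exp (-(c ^ 2 / 8)) := by
  have hN' : (3 : ℝ) ≤ N := by exact_mod_cast hN
  have hD : 5 ≤ 2 * (N : ℝ) - 1 := by linarith
  have hat0 : 0 < Real.arctan (1 / c) := by
    rw [Real.arctan_pos]; positivity
  have hat1 := Real.arctan_lt_pi_div_two (1 / c)
  have hpi := Real.pi_le_four
  have hbound : ∀ θ ∈ Set.uIoc (Real.arctan (1 / c)) (Real.pi / 2), ‖angularIntegrand N θ‖ ≤
      (2 * (N : ℝ) - 1) ^ (2 * N) * Real.exp (-(c ^ 2 / 8)) := by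
    intro θ hθ
    rw [Set.uIoc_of_le hat1.le] at hθ
    have h0 : 0 ≤ angularIntegrand N θ :=
      mul_nonneg (sq_nonneg _) (prod_nonneg fun l _ => by positivity)
    rw [Real.norm_eq_abs, abs_of_nonneg h0]
    refine (angularIntegrand_le hN θ).trans ?_
    have hsin : 1 / (c ^ 2 + 1) ≤ Real.sin θ ^ 2 := by
      have h1 : Real.sin (Real.arctan (1 / c)) ≤ Real.sin θ :=
        Real.sin_le_sin_of_le_of_le_pi_div_two (by linarith) hθ.2 hθ.1.le
      have h2 : 0 ≤ Real.sin (Real.arctan (1 / c)) :=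
        Real.sin_nonneg_of_nonneg_of_le_pi hat0.le (by linarith)
      have h3 : Real.sin (Real.arctan (1 / c)) ^ 2 = 1 / (c ^ 2 + 1) := by
        rw [Real.sin_sq, Real.cos_sq_arctan]
        field_simp
        ring
      rw [← h3]
      gcongr
    have hD0 : 0 < 2 * (N : ℝ) - 1 := by linarith
    rw [← hcD] at hD ⊢
    have hc1 : 1 ≤ c ^ 2 := by nlinarith [sq_nonneg c]
    gcongr
    calc c ^ 2 / 8 ≤ ((c ^ 4) ^ 2 - 1) / (3 * c ^ 4) * (1 / (c ^ 2 + 1)) := by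
          rw [div_mul_div_comm, div_le_div_iff₀ (by norm_num) (by positivity)]
          have : ((c ^ 4) ^ 2) = (c ^ 2) ^ 4 := by ring
          rw [this]
          have h4 : c ^ 4 = (c ^ 2) ^ 2 := by ring
          rw [h4] at hD ⊢
          generalize c ^ 2 = x at *
          have h5 : 5 * x ^ 2 ≤ x ^ 4 := by nlinarith [sq_nonneg x]
          nlinarith [mul_nonneg (sq_nonneg x) (sub_nonneg.2 hc1)]
      _ ≤ _ := by
        have : 0 ≤ ((c ^ 4) ^ 2 - 1) / (3 * c ^ 4) := by
          apply div_nonneg _ (by positivity)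
          nlinarith
        gcongr
  have h := intervalIntegral.norm_integral_le_of_norm_le_const hbound
  rw [Real.norm_eq_abs] at h
  refine h.trans ?_
  have h1 : |Real.pi / 2 - Real.arctan (1 / c)| ≤ 2 := by
    rw [abs_of_nonneg (by linarith)]; linarith
  have h2 : 0 ≤ (2 * (N : ℝ) - 1) ^ (2 * N) * Real.exp (-(c ^ 2 / 8)) :=
    mul_nonneg (pow_nonneg (by linarith) _) (Real.exp_nonneg _)
  calc _ ≤ (2 * (N : ℝ) - 1) ^ (2 * N) * Real.exp (-(c ^ 2 / 8)) * 2 := by gcongr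
    _ = _ := by ring

lemma exp_neg_le_inv_pow (K : ℕ) : ∃ C : ℝ, 0 ≤ C ∧ ∀ x : ℝ, 0 < x →
    Real.exp (-(x / 8)) ≤ C * (1 / x) ^ K := by
  refine ⟨(K ! : ℝ) * 8 ^ K, by positivity, fun x hx => ?_⟩
  have h := Real.pow_div_factorial_le_exp (x / 8) (by positivity) K
  rw [Real.exp_neg]
  have h0 : 0 < (x / 8) ^ K / (K ! : ℝ) := by positivity
  refine (inv_anti₀ h0 h).trans_eq ?_
  rw [div_pow, one_div_pow]
  field_simp

/-- The number of lines, normalized, has an asymptotic expansion in powers of the inverse of the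
degree `2 N - 1`. -/
theorem exists_abs_lineCount_sub_le (K : ℕ) : ∃ C : ℝ, 0 ≤ C ∧ ∀ N : ℕ, 3 ≤ N →
    |(lineCount (N + 1) : ℝ) / (Real.sqrt (27 / Real.pi) *
        (2 * (N : ℝ) - 1) ^ (2 * (N : ℝ) - 3 / 2)) -
      ∑ k ∈ range K, (degreeCoeff k : ℝ) * (1 / (2 * (N : ℝ) - 1)) ^ k| ≤
      C * (1 / (2 * (N : ℝ) - 1)) ^ K := by
  obtain ⟨C₁, hC₁, h₁⟩ := exists_abs_integral_laplaceRatio_sub_le K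
  obtain ⟨C₂, hC₂, h₂⟩ := exp_neg_le_inv_pow (2 * K + 3)
  have hq : 0 < Real.sqrt (27 * Real.pi) / 4 := by have := Real.pi_pos; positivity
  refine ⟨(C₁ + 2 * C₂) / (Real.sqrt (27 * Real.pi) / 4), by positivity, fun N hN => ?_⟩
  have hN' : (3 : ℝ) ≤ N := by exact_mod_cast hN
  have hD : 5 ≤ 2 * (N : ℝ) - 1 := by linarith
  have hD0 : 0 < 2 * (N : ℝ) - 1 := by linarith
  -- In the variable `s = √D tan θ` with `D = 2 N - 1` the integral is cut at `s = c = D ^ (1 / 4)`,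
  -- that is at `y = s² = √D`. Relative to `D ^ (2 N)`, the tail is at most of order
  -- `exp (-c² / 8)`, hence smaller than any power of `1 / D = 1 / c ^ 4`.
  set c : ℝ := (2 * (N : ℝ) - 1) ^ (1 / 4 : ℝ) with hcdef
  have hc : 0 < c := Real.rpow_pos_of_pos hD0 _
  have hcD : c ^ 4 = 2 * N - 1 := by
    rw [hcdef, ← Real.rpow_natCast, ← Real.rpow_mul hD0.le]
    norm_num
  have h3 := h₁ N hN c hc hcD
  have h4 := integral_angularIntegrand_tail_le hN hc hcD
  have h5 := h₂ (c ^ 2) (by positivity)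
  have hI : ∀ a b, IntervalIntegrable (angularIntegrand N) MeasureTheory.volume a b := fun a b =>
    (continuous_angularIntegrand N).intervalIntegrable a b
  have h6 := lineCount_eq_integral (N := N) (by omega)
  rw [← intervalIntegral.integral_add_adjacent_intervals (hI 0 (Real.arctan (1 / c))) (hI _ _),
    integral_angularIntegrand_main hN hc hcD] at h6
  have hpow : (2 * (N : ℝ) - 1) ^ (2 * (N : ℝ) - 3 / 2) = (2 * (N : ℝ) - 1) ^ (2 * N) / c ^ 6 := by
    rw [Real.rpow_sub hD0, hcdef, ← Real.rpow_natCast _ 6, ← Real.rpow_mul hD0.le,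
      ← Real.rpow_natCast _ (2 * N)]
    push_cast
    norm_num
  rw [hpow, h6]
  set D := 2 * (N : ℝ) - 1 with hDdef
  set J := ∫ s in (0 : ℝ)..c, s ^ 2 * Real.exp (-(1 / 3) * s ^ 2) * laplaceRatio (N, s ^ 2)
  set T := ∫ θ in Real.arctan (1 / c)..(Real.pi / 2), angularIntegrand N θ
  set S := ∑ k ∈ range K, (degreeCoeff k : ℝ) * (1 / D) ^ k
  have hP : 0 < D ^ (2 * N) := by positivity
  have hs : Real.sqrt (27 / Real.pi) * Real.pi = Real.sqrt (27 * Real.pi) := by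
    have := Real.pi_pos
    rw [← Real.sqrt_sq (show 0 ≤ Real.sqrt (27 / Real.pi) * Real.pi by positivity), mul_pow,
      Real.sq_sqrt (by positivity)]
    congr 1
    field_simp
  have e1 : 4 / Real.pi * (D ^ (2 * N) / c ^ 6 * J + T) /
      (Real.sqrt (27 / Real.pi) * (D ^ (2 * N) / c ^ 6)) - S =
      ((J - Real.sqrt (27 * Real.pi) / 4 * S) + c ^ 6 / D ^ (2 * N) * T) /
        (Real.sqrt (27 * Real.pi) / 4) := by
    have h1 : Real.sqrt (27 / Real.pi) ≠ 0 := by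
      have := Real.pi_pos
      positivity
    have := Real.pi_pos
    rw [← hs]
    field_simp
    ring
  rw [e1, abs_div, abs_of_pos hq, div_mul_eq_mul_div (C₁ + 2 * C₂)]
  gcongr
  refine (abs_add_le _ _).trans ?_
  rw [add_mul]
  refine add_le_add h3 ?_
  rw [abs_mul, abs_of_pos (by positivity)]
  calc c ^ 6 / D ^ (2 * N) * |T| ≤ c ^ 6 / D ^ (2 * N) *
        (2 * D ^ (2 * N) * (C₂ * (1 / c ^ 2) ^ (2 * K + 3))) := by
        refine mul_le_mul_of_nonneg_left (h4.trans ?_) (by positivity)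
        gcongr
    _ = _ := by
      rw [← hcD]
      rw [one_div_pow, one_div_pow, ← pow_mul, ← pow_mul, ← pow_mul,
        show 2 * (2 * K + 3) = 4 * K + 6 by ring, pow_add]
      field_simp

/-! ### Expansions in powers of 1 / n -/

/-- The scale of the powers of `1 / n` for `n ≥ max n₀ 1`, with rational coefficients. -/
def natScale (n₀ : ℕ) : Scale ℕ ℚ where
  carrier := {n | n₀ ≤ n ∧ 1 ≤ n}
  eps n := 1 / (n : ℝ)
  wt _ := 1
  ev _ := Rat.castHom ℝ
  eps_nonneg := fun n _ => by positivity
  eps_le_one := fun n hn => by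
    have : (1 : ℝ) ≤ n := by exact_mod_cast hn.2
    rw [div_le_one (by linarith)]
    exact this
  one_le_wt := fun _ _ => le_rfl
  ev_bound := fun r => ⟨|(r : ℝ)|, 0, fun _ _ => by simp⟩

lemma natScale_small_iff {n₀ K : ℕ} {f : ℕ → ℝ} : (natScale n₀).Small K f ↔
    ∃ C : ℝ, 0 ≤ C ∧ ∀ n : ℕ, n₀ ≤ n → 1 ≤ n → |f n| ≤ C * (1 / (n : ℝ)) ^ K := by
  constructor
  · rintro ⟨C, M, hC, h⟩
    exact ⟨C, hC, fun n h1 h2 => by simpa [natScale] using h n ⟨h1, h2⟩⟩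
  · rintro ⟨C, hC, h⟩
    exact ⟨C, 0, hC, fun n hn => by simpa [natScale] using h n hn.1 hn.2⟩

lemma hasAsymptoticExpansion_of_hasExp {n₀ : ℕ} {f : ℕ → ℝ} {F : PowerSeries ℚ}
    (h : (natScale n₀).HasExp f F) {c : ℕ → ℚ} (hc : ∀ k, PowerSeries.coeff k F = c k) :
    HasAsymptoticExpansion f c := by
  intro K
  obtain ⟨C, hC, hb⟩ := natScale_small_iff.1 (h.small_sub_sum K)
  refine IsBigO.of_bound C ?_
  filter_upwards [eventually_ge_atTop n₀, eventually_ge_atTop 1] with n h1 h2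
  have := hb n h1 h2
  rw [Real.norm_eq_abs, Real.norm_eq_abs, abs_of_nonneg (show 0 ≤ 1 / (n : ℝ) ^ K by positivity),
    ← one_div_pow]
  refine le_trans (le_of_eq ?_) this
  congr 2
  refine sum_congr rfl fun k _ => ?_
  rw [hc]
  simp only [natScale, eq_ratCast]
  rw [one_div_pow, mul_one_div]

lemma natScale_hasExp_of {n₀ : ℕ} {f : ℕ → ℝ} {c : ℕ → ℚ}
    (h : ∀ K, ∃ C : ℝ, 0 ≤ C ∧ ∀ n : ℕ, n₀ ≤ n → 1 ≤ n →
      |f n - ∑ k ∈ range K, (c k : ℝ) * (1 / (n : ℝ)) ^ k| ≤ C * (1 / (n : ℝ)) ^ K) :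
    (natScale n₀).HasExp f (PowerSeries.mk c) :=
  Scale.hasExp_of_small_sub_sum fun K => natScale_small_iff.2 <| by
    simpa [natScale, PowerSeries.coeff_mk] using h K

lemma natScale_hasExp_eps (n₀ : ℕ) :
    (natScale n₀).HasExp (fun n => 1 / (n : ℝ)) PowerSeries.X := by
  have := Scale.hasExp_evp (Γ := natScale n₀) (X : ℚ[X])
  rw [Polynomial.coe_X] at this
  exact this.congr fun n _ => by simp [Scale.evp, natScale]

lemma natScale_hasExp_const (n₀ : ℕ) (q : ℚ) :
    (natScale n₀).HasExp (fun _ => (q : ℝ)) (PowerSeries.C q) := by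
  have := Scale.hasExp_evp (Γ := natScale n₀) (Polynomial.C q : ℚ[X])
  rw [Polynomial.coe_C] at this
  exact this.congr fun n _ => by simp [Scale.evp, natScale]

lemma abs_inv_one_sub_sub_geom_le {z : ℝ} (hz : |z| ≤ 1 / 2) (K : ℕ) :
    |(1 - z)⁻¹ - ∑ k ∈ range K, z ^ k| ≤ 2 * |z| ^ K := by
  have hz1 := abs_le.1 hz
  have h1 : 1 - z ≠ 0 := by linarith
  have hg := mul_neg_geom_sum z K
  have : (1 - z)⁻¹ - ∑ k ∈ range K, z ^ k = z ^ K * (1 - z)⁻¹ := by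
    field_simp
    linarith
  rw [this, abs_mul, abs_pow, mul_comm, abs_of_pos (by apply inv_pos.2; linarith)]
  gcongr
  rw [inv_le_comm₀ (by linarith) (by norm_num)]
  linarith

/-- The power series `a x / (1 - b x)`. -/
def moebiusSeries (a b : ℚ) : PowerSeries ℚ :=
  PowerSeries.C a * PowerSeries.X * PowerSeries.mk fun k => b ^ k

lemma hasExp_moebius (a b : ℚ) {n₀ : ℕ} (hn : 2 * |(b : ℝ)| ≤ n₀) :
    (natScale n₀).HasExp (fun n => (a : ℝ) * (1 / (n : ℝ)) * (1 - b * (1 / (n : ℝ)))⁻¹)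
      (moebiusSeries a b) := by
  refine ((natScale_hasExp_const n₀ a).mul (natScale_hasExp_eps n₀)).mul
    (natScale_hasExp_of fun K => ⟨2 * |(b : ℝ)| ^ K, by positivity, fun n h1 h2 => ?_⟩)
  have hn0 : (0 : ℝ) < n := by exact_mod_cast h2
  have hz : |(b : ℝ) * (1 / n)| ≤ 1 / 2 := by
    have : (n₀ : ℝ) ≤ n := by exact_mod_cast h1
    rw [abs_mul, abs_of_pos (show 0 < 1 / (n : ℝ) by positivity), mul_one_div,
      div_le_iff₀ hn0]
    linarith
  have h := abs_inv_one_sub_sub_geom_le hz K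
  rw [abs_mul, abs_of_pos (show 0 < 1 / (n : ℝ) by positivity), mul_pow, ← mul_assoc] at h
  refine le_trans (le_of_eq ?_) h
  congr 2
  refine sum_congr rfl fun k _ => ?_
  push_cast
  rw [mul_pow]

lemma coeff_moebiusSeries_pow (a b : ℚ) {j k : ℕ} (hj : 1 ≤ j) (hjk : j ≤ k) :
    PowerSeries.coeff k (moebiusSeries a b ^ j) =
      a ^ j * (Nat.choose (k - 1) (k - j) : ℚ) * b ^ (k - j) := by
  obtain ⟨d, rfl⟩ := Nat.exists_eq_add_of_le' hj
  obtain ⟨m, rfl⟩ := Nat.exists_eq_add_of_le' hjk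
  have h1 : (PowerSeries.mk fun k => b ^ k) = PowerSeries.rescale b (PowerSeries.mk 1) := by
    ext k
    simp [PowerSeries.coeff_rescale]
  rw [moebiusSeries, h1, mul_pow, mul_pow, ← map_pow, ← map_pow,
    PowerSeries.mk_one_pow_eq_mk_choose_add, mul_assoc, PowerSeries.coeff_C_mul,
    PowerSeries.coeff_X_pow_mul, PowerSeries.coeff_rescale, PowerSeries.coeff_mk,
    Nat.add_sub_cancel]
  have h2 : m + (d + 1) - 1 = d + m := by omega
  rw [h2, ← Nat.choose_symm_add]
  ring

lemma coeff_zero_moebiusSeries (a b : ℚ) : PowerSeries.coeff 0 (moebiusSeries a b) = 0 := by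
  simp [moebiusSeries]

lemma coeff_compSeries_degreeCoeff (k : ℕ) :
    PowerSeries.coeff k (Scale.compSeries degreeCoeff (moebiusSeries (1 / 2) (3 / 2))) =
      coeffC k := by
  rw [Scale.compSeries, PowerSeries.coeff_mk, coeffC]
  split_ifs with hk
  · subst hk
    simp
  · have e : range (k + 1) = insert 0 (Icc 1 k) := by ext j; simp; omega
    rw [e, sum_insert (by simp), pow_zero, PowerSeries.coeff_one, if_neg hk, smul_zero, zero_add]
    refine sum_congr rfl fun j hj => ?_
    have := mem_Icc.1 hj
    rw [coeff_moebiusSeries_pow _ _ this.1 this.2, smul_eq_mul, one_div_pow]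
    ring

/-- The normalized number of lines. -/
def lineRatio (n : ℕ) : ℝ := (lineCount n : ℝ) /
  (Real.sqrt (27 / Real.pi) * (2 * (n : ℝ) - 3) ^ (2 * (n : ℝ) - 7 / 2))

lemma hasExp_lineRatio {n₀ : ℕ} (hn : 4 ≤ n₀) : (natScale n₀).HasExp lineRatio
    (Scale.compSeries degreeCoeff (moebiusSeries (1 / 2) (3 / 2))) := by
  have hn' : (4 : ℝ) ≤ n₀ := by exact_mod_cast hn
  refine (hasExp_moebius (1 / 2) (3 / 2) (by push_cast; rw [abs_of_pos] <;> linarith)).comp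
    (coeff_zero_moebiusSeries _ _) fun K => ?_
  obtain ⟨C, hC, h⟩ := exists_abs_lineCount_sub_le K
  refine ⟨C, hC, fun n hn1 => ?_⟩
  have h4 : n₀ ≤ n := hn1.1
  obtain ⟨N, rfl⟩ : ∃ N, n = N + 1 := ⟨n - 1, by omega⟩
  have hN := h N (by omega)
  have hN3 : (3 : ℝ) ≤ N := by exact_mod_cast (show 3 ≤ N by omega)
  have e1 : 2 * ((N + 1 : ℕ) : ℝ) - 3 = 2 * N - 1 := by push_cast; ring
  have e2 : 2 * ((N + 1 : ℕ) : ℝ) - 7 / 2 = 2 * N - 3 / 2 := by push_cast; ring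
  have e3 : ((1 / 2 : ℚ) : ℝ) * (1 / ((N + 1 : ℕ) : ℝ)) *
      (1 - ((3 / 2 : ℚ) : ℝ) * (1 / ((N + 1 : ℕ) : ℝ)))⁻¹ = 1 / (2 * (N : ℝ) - 1) := by
    have h1 : (1 - ((3 / 2 : ℚ) : ℝ) * (1 / ((N + 1 : ℕ) : ℝ))) =
        (2 * N - 1) / (2 * ((N + 1 : ℕ) : ℝ)) := by
      push_cast
      field_simp
      ring
    rw [h1]
    push_cast
    field_simp
  rw [lineRatio, e1, e2, e3, abs_of_pos (show 0 < 1 / (2 * (N : ℝ) - 1) by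
    apply one_div_pos.2; linarith)]
  exact hN

/-- The expansion of the logarithm of a sequence with an expansion with constant term `1`. -/
lemma hasExp_log {n₀ : ℕ} {f : ℕ → ℝ} {F : PowerSeries ℚ} (hf : (natScale n₀).HasExp f F)
    (h0 : PowerSeries.coeff 0 F = 1) (hb : ∀ n, n₀ ≤ n → 1 ≤ n → |f n - 1| ≤ 1 / 2) :
    (natScale n₀).HasExp (fun n => Real.log (f n))
      (Scale.compSeries (fun j => if j = 0 then 0 else (-1 : ℚ) ^ (j - 1) / j) (F - 1)) := by
  have h1 := hf.sub (natScale_hasExp_const n₀ 1)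
  rw [map_one] at h1
  refine h1.comp (by rw [map_sub, h0]; simp) fun K => ?_
  simp only [Rat.cast_one]
  have hsum : ∀ (K : ℕ) (x : ℝ), ∑ j ∈ range (K + 1),
      ((if j = 0 then 0 else (-1 : ℚ) ^ (j - 1) / j : ℚ) : ℝ) * x ^ j = logTaylor K x := by
    intro K x
    rw [sum_range_succ', logTaylor]
    simp only [if_true, Rat.cast_zero, zero_mul, add_zero]
    refine sum_congr rfl fun j _ => ?_
    rw [if_neg (Nat.succ_ne_zero j), Nat.add_sub_cancel]
    push_cast
    ring
  have hlog : ∀ n ∈ (natScale n₀).carrier, ∀ K,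
      |Real.log (f n) - logTaylor K (f n - 1)| ≤ 2 * |f n - 1| ^ (K + 1) := by
    intro n hn K
    have := abs_log_one_add_sub_le (hb n hn.1 hn.2) K
    rwa [add_sub_cancel] at this
  cases K with
  | zero =>
    refine ⟨1, zero_le_one, fun n hn => ?_⟩
    have h2 := hlog n hn 0
    have h3 := hb n hn.1 hn.2
    simp only [logTaylor, range_zero, sum_empty, sub_zero, zero_add, pow_one] at h2
    simp only [range_zero, sum_empty, sub_zero, pow_zero, mul_one]
    linarith
  | succ K =>
    refine ⟨2, by norm_num, fun n hn => ?_⟩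
    rw [hsum]
    exact hlog n hn K

/-- A sequence with an expansion with constant term `1` is eventually close to `1`. -/
lemma exists_abs_sub_one_le {n₀ : ℕ} {f : ℕ → ℝ} {F : PowerSeries ℚ}
    (hf : (natScale n₀).HasExp f F) (h0 : PowerSeries.coeff 0 F = 1) :
    ∃ n₁, n₀ ≤ n₁ ∧ ∀ n, n₁ ≤ n → 1 ≤ n → |f n - 1| ≤ 1 / 2 := by
  obtain ⟨C, hC, h⟩ := natScale_small_iff.1 (hf.small_sub_sum 1)
  obtain ⟨m, hm⟩ := exists_nat_ge (2 * C)
  refine ⟨max n₀ m, le_max_left _ _, fun n h1 h2 => ?_⟩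
  have h3 := h n ((le_max_left _ _).trans h1) h2
  have h4 : (m : ℝ) ≤ n := by exact_mod_cast (le_max_right _ _).trans h1
  have h5 : (0 : ℝ) < n := by exact_mod_cast h2
  rw [sum_range_one, h0, map_one, pow_zero, pow_one, mul_one] at h3
  refine h3.trans ?_
  rw [mul_one_div, div_le_iff₀ h5]
  linarith

lemma coeff_compSeries_log (k : ℕ) :
    PowerSeries.coeff k (Scale.compSeries (fun j => if j = 0 then 0 else (-1 : ℚ) ^ (j - 1) / j)
      (PowerSeries.mk fun j => if j = 0 then 0 else coeffC j)) = logCoeff k := by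
  rw [Scale.compSeries, PowerSeries.coeff_mk, logCoeff]
  have e : range (k + 1) = insert 0 (Icc 1 k) := by ext j; simp; omega
  rw [e, sum_insert (by simp), if_pos rfl, zero_smul, zero_add]
  refine sum_congr rfl fun j hj => ?_
  have := mem_Icc.1 hj
  rw [if_neg (by omega), smul_eq_mul]

/-- The expansion of `n log (1 - 3 / (2 n))`. -/
lemma hasExp_mul_log_one_sub {n₀ : ℕ} (hn : 3 ≤ n₀) :
    (natScale n₀).HasExp (fun n => (n : ℝ) * Real.log (1 - 3 / (2 * (n : ℝ))))
      (PowerSeries.mk fun k => -(3 / 2 : ℚ) ^ (k + 1) / ((k : ℚ) + 1)) := by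
  refine natScale_hasExp_of fun K => ⟨2 * (3 / 2) ^ (K + 1), by positivity, fun n h1 h2 => ?_⟩
  have hn0 : (3 : ℝ) ≤ n := by exact_mod_cast hn.trans h1
  have hz0 : 0 ≤ 3 / (2 * (n : ℝ)) := by positivity
  have hz : 3 / (2 * (n : ℝ)) ≤ 1 / 2 := by
    rw [div_le_div_iff₀ (by linarith) (by norm_num)]; linarith
  have h := Real.abs_log_sub_add_sum_range_le (x := 3 / (2 * (n : ℝ)))
    (by rw [abs_of_nonneg hz0]; linarith) K
  rw [abs_of_nonneg hz0] at h
  have h3 : (3 / (2 * (n : ℝ))) ^ (K + 1) / (1 - 3 / (2 * (n : ℝ))) ≤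
      2 * (3 / (2 * (n : ℝ))) ^ (K + 1) := by
    rw [div_le_iff₀ (by linarith)]
    nlinarith [pow_nonneg hz0 (K + 1)]
  have e : (n : ℝ) * Real.log (1 - 3 / (2 * (n : ℝ))) - ∑ k ∈ range K,
      ((-(3 / 2 : ℚ) ^ (k + 1) / ((k : ℚ) + 1) : ℚ) : ℝ) * (1 / (n : ℝ)) ^ k =
      n * ((∑ i ∈ range K, (3 / (2 * (n : ℝ))) ^ (i + 1) / ((i : ℝ) + 1)) +
        Real.log (1 - 3 / (2 * (n : ℝ)))) := by
    rw [mul_add, mul_sum, sub_eq_add_neg, ← sum_neg_distrib, add_comm]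
    congr 1
    refine sum_congr rfl fun k _ => ?_
    push_cast
    rw [show 3 / (2 * (n : ℝ)) = 3 / 2 * (1 / n) by field_simp, mul_pow, pow_succ (1 / (n : ℝ))]
    field_simp
  rw [e, abs_mul, abs_of_nonneg (by linarith : (0 : ℝ) ≤ n)]
  calc (n : ℝ) * _ ≤ n * (2 * (3 / (2 * (n : ℝ))) ^ (K + 1)) := by
        gcongr
        exact h.trans h3
    _ = _ := by
      rw [show 3 / (2 * (n : ℝ)) = 3 / 2 * (1 / n) by field_simp, mul_pow, pow_succ (1 / (n : ℝ))]
      field_simp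

/-! ### The Stirling series -/

/-- The coefficients of the Stirling series. At `k = 0` the value is `0` by division by zero. -/
def stirlingCoeff (k : ℕ) : ℚ := bernoulli (k + 1) / ((k : ℚ) * ((k : ℚ) + 1))

/-- The coefficients of the expansion of `(m + 1 / 2) log (1 + 1 / m) - 1`. -/
def stirlingStep (k : ℕ) : ℚ :=
  (-1 : ℚ) ^ k / ((k : ℚ) + 1) + (if k = 0 then 0 else (-1 : ℚ) ^ (k - 1) / (2 * (k : ℚ))) -
    if k = 0 then 1 else 0

/-- The Stirling series `S` satisfies the formal difference equation
`S(x) - S(x / (1 + x)) = (1 / x + 1 / 2) log (1 + x) - 1`; this is the value at `-1` of the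
Bernoulli polynomials. -/
lemma stirlingCoeff_sub_sum (j : ℕ) :
    stirlingCoeff j - ∑ k ∈ range (j + 1), stirlingCoeff k *
      PowerSeries.coeff j (moebiusSeries 1 (-1) ^ k) = stirlingStep j := by
  rcases Nat.eq_zero_or_pos j with rfl | hj
  · simp [stirlingCoeff, stirlingStep]
  replace hj : 1 ≤ j := hj
  have e : range (j + 1) = insert 0 (Icc 1 j) := by ext i; simp; omega
  rw [e, sum_insert (by simp)]
  have h0 : stirlingCoeff 0 = 0 := by simp [stirlingCoeff]
  rw [h0, zero_mul, zero_add, stirlingStep, if_neg (by omega), if_neg (by omega)]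
  have hj0 : (j : ℚ) ≠ 0 := by positivity
  have hj1 : (j : ℚ) + 1 ≠ 0 := by positivity
  have h1 : ∀ k ∈ Icc 1 j, stirlingCoeff k * PowerSeries.coeff j (moebiusSeries 1 (-1) ^ k) =
      (-1) ^ (j - k) * (bernoulli (k + 1) * (Nat.choose (j + 1) (k + 1) : ℚ)) / (j * (j + 1)) := by
    intro k hk
    obtain ⟨hk1, hk2⟩ := mem_Icc.1 hk
    rw [coeff_moebiusSeries_pow _ _ hk1 hk2, stirlingCoeff, one_pow, one_mul]
    obtain ⟨a, rfl⟩ := Nat.exists_eq_add_of_le' hk1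
    obtain ⟨b, rfl⟩ := Nat.exists_eq_add_of_le' hj
    have c1 : (b + 1 - 1).choose (b + 1 - (a + 1)) = b.choose a := by
      rw [Nat.add_sub_cancel, Nat.add_sub_add_right, Nat.choose_symm (by omega)]
    have c2 := Nat.add_one_mul_choose_eq b a
    have c3 := Nat.add_one_mul_choose_eq (b + 1) (a + 1)
    have c2' : ((b : ℚ) + 1) * (b.choose a : ℚ) = ((b + 1).choose (a + 1) : ℚ) * (a + 1) := by
      exact_mod_cast c2
    have c3' : ((b : ℚ) + 1 + 1) * ((b + 1).choose (a + 1) : ℚ) =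
        ((b + 1 + 1).choose (a + 1 + 1) : ℚ) * (a + 1 + 1) := by
      exact_mod_cast c3
    rw [c1, Nat.add_sub_add_right]
    push_cast
    have hab : (b.choose a : ℚ) * ((b + 1) * (b + 1 + 1)) =
        ((b + 1 + 1).choose (a + 1 + 1) : ℚ) * ((a + 1) * (a + 1 + 1)) := by
      linear_combination ((b : ℚ) + 1 + 1) * c2' + ((a : ℚ) + 1) * c3'
    rw [div_mul_eq_mul_div, div_eq_div_iff (by positivity) (by positivity)]
    linear_combination (bernoulli (a + 1 + 1) * (-1) ^ (b - a)) * hab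
  rw [sum_congr rfl h1, ← sum_div]
  have h2 := Polynomial.bernoulli_eval_one_add (j + 1) (-1)
  rw [add_neg_cancel, Polynomial.bernoulli_eval_zero, Nat.add_sub_cancel] at h2
  have h3 : (Polynomial.bernoulli (j + 1)).eval (-1 : ℚ) = (-1) ^ (j + 1) -
      ((j : ℚ) + 1) / 2 * (-1) ^ j + ∑ k ∈ Icc 1 j,
        (-1) ^ (j - k) * (bernoulli (k + 1) * (Nat.choose (j + 1) (k + 1) : ℚ)) := by
    rw [Polynomial.bernoulli, eval_finsetSum]
    simp only [eval_monomial]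
    rw [sum_range_succ', sum_range_succ']
    have : ∑ k ∈ Icc 1 j, (-1 : ℚ) ^ (j - k) *
        (bernoulli (k + 1) * (Nat.choose (j + 1) (k + 1) : ℚ)) = ∑ k ∈ range j,
        (-1 : ℚ) ^ (j - (k + 1)) *
        (bernoulli (k + 1 + 1) * (Nat.choose (j + 1) (k + 1 + 1) : ℚ)) := by
      rw [range_eq_Ico, sum_Ico_add' (fun k => (-1 : ℚ) ^ (j - k) *
        (bernoulli (k + 1) * (Nat.choose (j + 1) (k + 1) : ℚ))) 0 j 1]
      rfl
    rw [this]
    simp only [zero_add, _root_.bernoulli_zero, _root_.bernoulli_one, Nat.choose_zero_right,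
      Nat.choose_one_right, Nat.add_sub_cancel, Nat.sub_zero, Nat.add_sub_add_right]
    push_cast
    rw [sum_congr rfl fun k _ => mul_comm _ _]
    ring
  rw [h3] at h2
  generalize ∑ k ∈ Icc 1 j, (-1) ^ (j - k) *
    (bernoulli (k + 1) * (Nat.choose (j + 1) (k + 1) : ℚ)) = S at *
  have h4 : S = bernoulli (j + 1) - (-1) ^ (j + 1) + ((j : ℚ) + 1) / 2 * (-1) ^ j -
      (j + 1) * (-1) ^ j := by
    rw [h2]; push_cast; ring
  rw [h4, stirlingCoeff]
  obtain ⟨b, rfl⟩ := Nat.exists_eq_add_of_le' hj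
  rw [Nat.add_sub_cancel]
  field_simp
  ring

/-- The remainder in the Stirling formula for `log m!`. -/
def stirlingRemainder (m : ℕ) : ℝ :=
  Real.log (m ! : ℝ) - (((m : ℝ) + 1 / 2) * Real.log m - m + Real.log (2 * Real.pi) / 2)

lemma tendsto_stirlingRemainder : Tendsto stirlingRemainder atTop (𝓝 0) := by
  have h := (Stirling.tendsto_stirlingSeq_sqrt_pi.log (by
    have := Real.pi_pos; positivity)).sub_const (Real.log (√Real.pi))
  rw [sub_self] at h
  refine h.congr' ?_
  filter_upwards [eventually_ge_atTop 1] with m hm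
  have hm0 : (0 : ℝ) < m := by exact_mod_cast hm
  rw [Stirling.log_stirlingSeq_formula, stirlingRemainder, Real.log_sqrt Real.pi_pos.le,
    Real.log_mul (by norm_num) Real.pi_ne_zero, Real.log_mul (by norm_num) hm0.ne',
    Real.log_div hm0.ne' (Real.exp_ne_zero 1), Real.log_exp]
  ring

lemma stirlingRemainder_sub {m : ℕ} (hm : 1 ≤ m) :
    stirlingRemainder m - stirlingRemainder (m + 1) =
      ((m : ℝ) + 1 / 2) * Real.log (1 + 1 / m) - 1 := by
  have hm0 : (0 : ℝ) < m := by exact_mod_cast hm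
  have e : 1 + 1 / (m : ℝ) = ((m + 1 : ℕ) : ℝ) / m := by push_cast; field_simp
  rw [e, Real.log_div (by positivity) hm0.ne', stirlingRemainder, stirlingRemainder,
    Nat.factorial_succ]
  push_cast
  rw [Real.log_mul (show (m : ℝ) + 1 ≠ 0 by positivity) (show (m ! : ℝ) ≠ 0 by positivity)]
  ring

lemma hasExp_stirlingRemainder_sub : (natScale 2).HasExp
    (fun m => stirlingRemainder m - stirlingRemainder (m + 1)) (PowerSeries.mk stirlingStep) := by
  have h1 : (natScale 2).HasExp (fun m : ℕ => (m : ℝ) * Real.log (1 + 1 / m))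
      (PowerSeries.mk fun k => (-1 : ℚ) ^ k / ((k : ℚ) + 1)) := by
    refine natScale_hasExp_of fun K => ⟨2, by norm_num, fun m h1 h2 => ?_⟩
    have hm : (2 : ℝ) ≤ m := by exact_mod_cast h1
    have hz : |1 / (m : ℝ)| ≤ 1 / 2 := by
      rw [abs_of_pos (by positivity), div_le_div_iff₀ (by linarith) (by norm_num)]
      linarith
    have h := abs_log_one_add_sub_le hz K
    rw [abs_of_pos (by positivity : 0 < 1 / (m : ℝ))] at h
    have e : (m : ℝ) * Real.log (1 + 1 / m) - ∑ k ∈ range K,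
        (((-1 : ℚ) ^ k / ((k : ℚ) + 1) : ℚ) : ℝ) * (1 / (m : ℝ)) ^ k =
        m * (Real.log (1 + 1 / m) - logTaylor K (1 / m)) := by
      rw [mul_sub, logTaylor, mul_sum]
      congr 1
      refine sum_congr rfl fun k _ => ?_
      push_cast
      rw [pow_succ (1 / (m : ℝ))]
      field_simp
    rw [e, abs_mul, abs_of_nonneg (by linarith : (0 : ℝ) ≤ m)]
    calc (m : ℝ) * _ ≤ m * (2 * (1 / (m : ℝ)) ^ (K + 1)) := by gcongr
      _ = _ := by
        rw [pow_succ (1 / (m : ℝ))]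
        field_simp
  have h2 := ((natScale_hasExp_eps 2).mul h1).const_mul (1 / 2)
  have h3 := (h1.add h2).sub (natScale_hasExp_const 2 1)
  have e : (PowerSeries.mk fun k => (-1 : ℚ) ^ k / ((k : ℚ) + 1)) +
      (1 / 2 : ℚ) • (PowerSeries.X * PowerSeries.mk fun k => (-1 : ℚ) ^ k / ((k : ℚ) + 1)) -
      PowerSeries.C 1 = PowerSeries.mk stirlingStep := by
    ext k
    rw [map_sub, map_add, PowerSeries.coeff_smul, PowerSeries.coeff_mk, PowerSeries.coeff_mk,
      stirlingStep, PowerSeries.coeff_C]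
    congr 2
    cases k with
    | zero => simp
    | succ k =>
      rw [PowerSeries.coeff_succ_X_mul, PowerSeries.coeff_mk, if_neg (Nat.succ_ne_zero k),
        Nat.add_sub_cancel]
      push_cast
      rw [smul_eq_mul]
      field_simp
  rw [e] at h3
  refine h3.congr fun m hm => ?_
  have hm0 : (0 : ℝ) < m := by exact_mod_cast hm.2
  rw [stirlingRemainder_sub hm.2]
  push_cast
  field_simp

/-- The Stirling series: the differences of consecutive remainders agree with those of the partial
sums of the series to sufficient order, and both tend to `0`. -/
lemma hasExp_stirlingRemainder :
    (natScale 2).HasExp stirlingRemainder (PowerSeries.mk stirlingCoeff) := by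
  intro K
  refine ⟨∑ k ∈ range (K + 2), monomial k (stirlingCoeff k), fun k hk => ?_, ?_⟩
  · rw [finsetSum_coeff, sum_eq_single k, coeff_monomial_same, PowerSeries.coeff_mk]
    · intro b _ hb
      exact coeff_monomial_of_ne _ hb.symm
    · intro h
      exact absurd (mem_range.2 (by omega)) h
  set g : ℕ → ℝ := fun m =>
    stirlingRemainder m - ∑ k ∈ range (K + 2), (stirlingCoeff k : ℝ) * (1 / (m : ℝ)) ^ k with hg
  have hg0 : Tendsto g atTop (𝓝 0) := by
    have h : Tendsto (fun m : ℕ => ∑ k ∈ range (K + 2), (stirlingCoeff k : ℝ) *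
        (1 / (m : ℝ)) ^ k) atTop (𝓝 (∑ k ∈ range (K + 2), (stirlingCoeff k : ℝ) * 0 ^ k)) :=
      tendsto_finsetSum _ fun k _ => (tendsto_one_div_atTop_nhds_zero_nat.pow k).const_mul _
    have e : ∑ k ∈ range (K + 2), (stirlingCoeff k : ℝ) * 0 ^ k = 0 := by
      rw [sum_range_succ']
      simp [stirlingCoeff]
    rw [e] at h
    have h' := tendsto_stirlingRemainder.sub h
    rwa [sub_zero] at h'
  -- The difference of the partial sums at `m` and `m + 1` has the expansion `F`.
  set F : PowerSeries ℚ := ∑ k ∈ range (K + 2),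
    stirlingCoeff k • (PowerSeries.X ^ k - moebiusSeries 1 (-1) ^ k) with hF
  have hdiff : (natScale 2).HasExp (fun m => g m - g (m + 1))
      (PowerSeries.mk stirlingStep - F) := by
    have h1 : (natScale 2).HasExp (fun m => ∑ k ∈ range (K + 2), (stirlingCoeff k : ℝ) *
        ((1 / (m : ℝ)) ^ k - (((1 : ℚ) : ℝ) * (1 / (m : ℝ)) *
          (1 - ((-1 : ℚ) : ℝ) * (1 / (m : ℝ)))⁻¹) ^ k)) F :=
      Scale.hasExp_sum _ fun k _ => (((natScale_hasExp_eps 2).pow k).sub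
        ((hasExp_moebius 1 (-1) (by norm_num)).pow k)).const_mul _
    refine (hasExp_stirlingRemainder_sub.sub h1).congr fun m hm => ?_
    have hm0 : (0 : ℝ) < m := by exact_mod_cast hm.2
    have e : ((1 : ℚ) : ℝ) * (1 / (m : ℝ)) * (1 - ((-1 : ℚ) : ℝ) * (1 / (m : ℝ)))⁻¹ =
        1 / ((m + 1 : ℕ) : ℝ) := by
      push_cast
      field_simp
      ring
    rw [e, hg]
    simp only [mul_sub, sum_sub_distrib]
    ring
  have hcoeff : ∀ j < K + 2, PowerSeries.coeff j (PowerSeries.mk stirlingStep - F) = 0 := by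
    intro j hj
    rw [map_sub, PowerSeries.coeff_mk, ← stirlingCoeff_sub_sum, hF, map_sum]
    simp only [PowerSeries.coeff_smul, map_sub, smul_sub, sum_sub_distrib, smul_eq_mul,
      PowerSeries.coeff_X_pow]
    have e1 : ∑ k ∈ range (K + 2), stirlingCoeff k * (if j = k then 1 else 0) =
        stirlingCoeff j := by
      rw [sum_eq_single j]
      · simp
      · intro b _ hb
        rw [if_neg hb.symm, mul_zero]
      · intro h
        exact absurd (mem_range.2 hj) h
    have e2 : ∑ k ∈ range (j + 1), stirlingCoeff k *
        PowerSeries.coeff j (moebiusSeries 1 (-1) ^ k) = ∑ k ∈ range (K + 2), stirlingCoeff k *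
        PowerSeries.coeff j (moebiusSeries 1 (-1) ^ k) := by
      refine sum_subset (range_subset_range.2 (by omega)) fun k _ hk => ?_
      rw [Scale.coeff_pow_eq_zero (coeff_zero_moebiusSeries _ _)
        (by rw [mem_range] at hk; omega), mul_zero]
    rw [e1, e2, sub_self]
  obtain ⟨C, hC, hb⟩ := natScale_small_iff.1 (hdiff.small_sub_sum (K + 2))
  have hb' : ∀ m : ℕ, 2 ≤ m → |g m - g (m + 1)| ≤ C * (1 / (m : ℝ)) ^ (K + 2) := by
    intro m hm
    have := hb m hm (by omega)
    rw [sum_eq_zero, sub_zero] at this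
    · exact this
    · intro k hk
      rw [hcoeff k (mem_range.1 hk), map_zero, zero_mul]
  -- The differences are of order `K + 2`, and `1 / x² ≤ 2 (1 / x - 1 / (x + 1))`, so that their sum
  -- telescopes with the loss of one order.
  have htel : ∀ m : ℕ, 2 ≤ m → ∀ i : ℕ, |g m - g (m + i)| ≤
      2 * C * (1 / (m : ℝ)) ^ K * (1 / (m : ℝ) - 1 / ((m + i : ℕ) : ℝ)) := by
    intro m hm i
    have hm0 : (2 : ℝ) ≤ m := by exact_mod_cast hm
    induction i with
    | zero => simp
    | succ i ih =>
      have h1 := hb' (m + i) (by omega)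
      have h2 := abs_add_le (g m - g (m + i)) (g (m + i) - g (m + i + 1))
      rw [sub_add_sub_cancel] at h2
      have hi : (m : ℝ) ≤ ((m + i : ℕ) : ℝ) := by
        push_cast
        linarith [(Nat.cast_nonneg i : (0 : ℝ) ≤ i)]
      have h3 : C * (1 / ((m + i : ℕ) : ℝ)) ^ (K + 2) ≤ 2 * C * (1 / (m : ℝ)) ^ K *
          (1 / ((m + i : ℕ) : ℝ) - 1 / ((m + (i + 1) : ℕ) : ℝ)) := by
        have e : ((m + (i + 1) : ℕ) : ℝ) = ((m + i : ℕ) : ℝ) + 1 := by push_cast; ring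
        rw [e]
        generalize ((m + i : ℕ) : ℝ) = x at *
        have hx : 0 < x := by linarith
        have h4 : (1 / x) ^ 2 ≤ 2 * (1 / x - 1 / (x + 1)) := by
          have : 2 * (1 / x - 1 / (x + 1)) = 2 / (x * (x + 1)) := by field_simp; ring
          rw [this, one_div_pow, div_le_div_iff₀ (by positivity) (by positivity)]
          nlinarith
        have h5 : (1 / x) ^ K ≤ (1 / (m : ℝ)) ^ K := by gcongr
        rw [pow_add]
        calc C * ((1 / x) ^ K * (1 / x) ^ 2) ≤
            C * ((1 / (m : ℝ)) ^ K * (2 * (1 / x - 1 / (x + 1)))) := by gcongr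
          _ = _ := by ring
      have e2 : m + (i + 1) = m + i + 1 := rfl
      rw [e2] at h3 ⊢
      refine h2.trans ((add_le_add ih (h1.trans h3)).trans_eq ?_)
      ring
  have hfin : ∀ m : ℕ, 2 ≤ m → |g m| ≤ 2 * C * (1 / (m : ℝ)) ^ (K + 1) := by
    intro m hm
    have hm0 : (2 : ℝ) ≤ m := by exact_mod_cast hm
    have h1 : Tendsto (fun i => |g m - g (m + i)|) atTop (𝓝 |g m|) := by
      have : Tendsto (fun i => g (m + i)) atTop (𝓝 0) := by
        simpa only [add_comm] using (tendsto_add_atTop_iff_nat m).2 hg0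
      simpa using (this.const_sub (g m)).abs
    refine le_of_tendsto' h1 fun i => (htel m hm i).trans ?_
    rw [pow_succ, ← mul_assoc]
    gcongr
    have : (0 : ℝ) ≤ 1 / ((m + i : ℕ) : ℝ) := by positivity
    linarith
  refine Scale.Small.mono (K := K + 1) (natScale_small_iff.2 ⟨2 * C, by positivity,
    fun m h1 _ => ?_⟩) (Nat.le_succ K)
  have := hfin m h1
  have e : (natScale 2).evp (∑ k ∈ range (K + 2), monomial k (stirlingCoeff k)) m =
      ∑ k ∈ range (K + 2), (stirlingCoeff k : ℝ) * (1 / (m : ℝ)) ^ k := by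
    rw [Scale.evp, eval₂_finsetSum]
    exact sum_congr rfl fun k _ => by simp [eval₂_monomial, natScale]
  rw [e]
  exact this

/-- The Stirling series at even arguments. -/
lemma hasExp_stirlingRemainder_two_mul {n₀ : ℕ} :
    (natScale n₀).HasExp (fun n => stirlingRemainder (2 * n))
      (PowerSeries.mk fun k => stirlingCoeff k / 2 ^ k) := by
  refine natScale_hasExp_of fun K => ?_
  obtain ⟨C, hC, h⟩ := natScale_small_iff.1 (hasExp_stirlingRemainder.small_sub_sum K)
  refine ⟨C, hC, fun n _ h2 => ?_⟩
  have := h (2 * n) (by omega) (by omega)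
  have e : 1 / ((2 * n : ℕ) : ℝ) = 1 / 2 * (1 / (n : ℝ)) := by push_cast; field_simp
  simp only [natScale, PowerSeries.coeff_mk, eq_ratCast] at this
  rw [e] at this
  refine le_trans (le_of_eq ?_) (this.trans ?_)
  · congr 2
    refine sum_congr rfl fun k _ => ?_
    push_cast
    rw [mul_pow, one_div_pow 2 k]
    ring
  · have : 0 ≤ 1 / (n : ℝ) := by positivity
    gcongr
    linarith

/-! ### The first coefficients and the logarithmic expansion -/

lemma momentFunctional_add (p q : ℚ[X]) :
    momentFunctional (p + q) = momentFunctional p + momentFunctional q :=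
  sum_add_index _ _ _ (fun _ => zero_mul _) fun _ _ _ => add_mul _ _ _

lemma momentFunctional_monomial (m : ℕ) (a : ℚ) : momentFunctional (monomial m a) =
    a * ((2 / 3 : ℚ) * (((2 * m)! : ℚ) / (m ! : ℚ)) * (3 / 4 : ℚ) ^ m) :=
  sum_monomial_index _ _ (zero_mul _)

lemma coeff_mul_two {R : Type*} [CommRing R] (A B : PowerSeries R) :
    PowerSeries.coeff 2 (A * B) =
      PowerSeries.coeff 0 A * PowerSeries.coeff 2 B +
      PowerSeries.coeff 1 A * PowerSeries.coeff 1 B +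
      PowerSeries.coeff 2 A * PowerSeries.coeff 0 B := by
  rw [PowerSeries.coeff_mul]
  simp [Finset.Nat.antidiagonal_succ]
  ring

lemma coeff_mul_three {R : Type*} [CommRing R] (A B : PowerSeries R) :
    PowerSeries.coeff 3 (A * B) =
      PowerSeries.coeff 0 A * PowerSeries.coeff 3 B +
      PowerSeries.coeff 1 A * PowerSeries.coeff 2 B +
      PowerSeries.coeff 2 A * PowerSeries.coeff 1 B +
      PowerSeries.coeff 3 A * PowerSeries.coeff 0 B := by
  rw [PowerSeries.coeff_mul]
  simp [Finset.Nat.antidiagonal_succ]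
  ring

lemma coeff_mul_four {R : Type*} [CommRing R] (A B : PowerSeries R) :
    PowerSeries.coeff 4 (A * B) =
      PowerSeries.coeff 0 A * PowerSeries.coeff 4 B +
      PowerSeries.coeff 1 A * PowerSeries.coeff 3 B +
      PowerSeries.coeff 2 A * PowerSeries.coeff 2 B +
      PowerSeries.coeff 3 A * PowerSeries.coeff 1 B +
      PowerSeries.coeff 4 A * PowerSeries.coeff 0 B := by
  rw [PowerSeries.coeff_mul]
  simp [Finset.Nat.antidiagonal_succ]
  ring

/-- The coefficients up to order `4` of the powers of a power series without constant term. -/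
lemma coeff_pow_small {R : Type*} [CommRing R] {A : PowerSeries R}
    (h0 : PowerSeries.coeff 0 A = 0) :
    PowerSeries.coeff 2 (A ^ 2) = PowerSeries.coeff 1 A ^ 2 ∧
    PowerSeries.coeff 3 (A ^ 2) = 2 * PowerSeries.coeff 1 A * PowerSeries.coeff 2 A ∧
    PowerSeries.coeff 4 (A ^ 2) =
      2 * PowerSeries.coeff 1 A * PowerSeries.coeff 3 A + PowerSeries.coeff 2 A ^ 2 ∧
    PowerSeries.coeff 3 (A ^ 3) = PowerSeries.coeff 1 A ^ 3 ∧
    PowerSeries.coeff 4 (A ^ 3) = 3 * PowerSeries.coeff 1 A ^ 2 * PowerSeries.coeff 2 A ∧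
    PowerSeries.coeff 4 (A ^ 4) = PowerSeries.coeff 1 A ^ 4 := by
  have s0 := Scale.coeff_pow_eq_zero h0 (show 0 < 2 by norm_num)
  have s1 := Scale.coeff_pow_eq_zero h0 (show 1 < 2 by norm_num)
  have c0 := Scale.coeff_pow_eq_zero h0 (show 0 < 3 by norm_num)
  have c1 := Scale.coeff_pow_eq_zero h0 (show 1 < 3 by norm_num)
  have c2 := Scale.coeff_pow_eq_zero h0 (show 2 < 3 by norm_num)
  have s2 : PowerSeries.coeff 2 (A ^ 2) = PowerSeries.coeff 1 A ^ 2 := by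
    rw [sq A, coeff_mul_two, h0]; ring
  have s3 : PowerSeries.coeff 3 (A ^ 2) =
      2 * PowerSeries.coeff 1 A * PowerSeries.coeff 2 A := by
    rw [sq A, coeff_mul_three, h0]; ring
  have c3 : PowerSeries.coeff 3 (A ^ 3) = PowerSeries.coeff 1 A ^ 3 := by
    rw [pow_succ A 2, coeff_mul_three, s0, s1, s2, h0]; ring
  refine ⟨s2, s3, ?_, c3, ?_, ?_⟩
  · rw [sq A, coeff_mul_four, h0]; ring
  · rw [pow_succ A 2, coeff_mul_four, s0, s1, s2, s3, h0]; ring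
  · rw [pow_succ A 3, coeff_mul_four, c0, c1, c2, c3, h0]; ring

lemma exponentSeries_one : PowerSeries.coeff 1 exponentSeries = monomial 2 (1 / 5 : ℚ) := by
  simp [exponentSeries, Finset.sum_filter, Finset.Nat.antidiagonal_succ]
  norm_num

lemma exponentSeries_two : PowerSeries.coeff 2 exponentSeries =
    monomial 3 (-1 / 7 : ℚ) + monomial 1 (1 / 3 : ℚ) := by
  simp [exponentSeries, Finset.sum_filter, Finset.Nat.antidiagonal_succ, bernoulli_two]
  norm_num

lemma exponentSeries_three : PowerSeries.coeff 3 exponentSeries =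
    monomial 4 (1 / 9 : ℚ) + monomial 2 (-1 / 3 : ℚ) := by
  simp [exponentSeries, Finset.sum_filter, Finset.Nat.antidiagonal_succ, bernoulli_two]
  norm_num [Nat.choose]

lemma exponentSeries_four : PowerSeries.coeff 4 exponentSeries =
    monomial 5 (-1 / 11 : ℚ) + monomial 3 (1 / 3 : ℚ) := by
  have b3 : bernoulli 3 = 0 := bernoulli_eq_zero_of_odd (by decide) (by norm_num)
  simp [exponentSeries, Finset.sum_filter, Finset.Nat.antidiagonal_succ, bernoulli_two, b3]
  norm_num [Nat.choose]

lemma expCoeff_zero : expCoeff 0 = 1 := by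
  simp [expCoeff]

lemma eval_expCoeff_one (y : ℚ) : (expCoeff 1).eval y = y ^ 2 / 5 := by
  simp [expCoeff, sum_range_succ, PowerSeries.coeff_one, exponentSeries_one]
  ring

lemma eval_expCoeff_two (y : ℚ) :
    (expCoeff 2).eval y = y / 3 - y ^ 3 / 7 + y ^ 4 / 50 := by
  obtain ⟨s2, -⟩ := coeff_pow_small coeff_zero_exponentSeries
  simp [expCoeff, sum_range_succ, PowerSeries.coeff_one, s2, exponentSeries_one,
    exponentSeries_two, Nat.factorial]
  ring

lemma eval_expCoeff_three (y : ℚ) : (expCoeff 3).eval y =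
    -y ^ 2 / 3 + y ^ 3 / 15 + y ^ 4 / 9 - y ^ 5 / 35 + y ^ 6 / 750 := by
  obtain ⟨-, s3, -, c3, -⟩ := coeff_pow_small coeff_zero_exponentSeries
  simp [expCoeff, sum_range_succ, PowerSeries.coeff_one, s3, c3, exponentSeries_one,
    exponentSeries_two, exponentSeries_three, Nat.factorial]
  ring

lemma eval_expCoeff_four (y : ℚ) : (expCoeff 4).eval y =
    y ^ 2 / 18 + y ^ 3 / 3 - 4 / 35 * y ^ 4 - 139 / 1650 * y ^ 5 + 143 / 4410 * y ^ 6 -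
      y ^ 7 / 350 + y ^ 8 / 15000 := by
  obtain ⟨-, -, s4, -, c4, q4⟩ := coeff_pow_small coeff_zero_exponentSeries
  simp [expCoeff, sum_range_succ, PowerSeries.coeff_one, s4, c4, q4, exponentSeries_one,
    exponentSeries_two, exponentSeries_three, exponentSeries_four, Nat.factorial]
  ring

lemma degreeCoeff_zero : degreeCoeff 0 = 1 := by
  simp [degreeCoeff, expCoeff_zero, momentFunctional_monomial]
  norm_num

lemma degreeCoeff_one : degreeCoeff 1 = -9 / 4 := by
  have h : ∑ p ∈ HasAntidiagonal.antidiagonal 1,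
      monomial (p.1 + 1) ((-1 : ℚ) ^ p.1 * ((p.1 : ℚ) + 1)) * expCoeff p.2 =
      monomial 2 (-2 : ℚ) + monomial 3 (1 / 5 : ℚ) := by
    refine Polynomial.funext fun y => ?_
    simp [Finset.Nat.antidiagonal_succ, expCoeff_zero, eval_expCoeff_one]
    ring
  rw [degreeCoeff, h]
  simp only [momentFunctional_add, momentFunctional_monomial]
  norm_num [Nat.factorial]

lemma degreeCoeff_two : degreeCoeff 2 = 969 / 160 := by
  have h : ∑ p ∈ HasAntidiagonal.antidiagonal 2,
      monomial (p.1 + 1) ((-1 : ℚ) ^ p.1 * ((p.1 : ℚ) + 1)) * expCoeff p.2 =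
      monomial 2 (1/3 : ℚ) + monomial 3 (3 : ℚ) + monomial 4 (-19/35 : ℚ) +
        monomial 5 (1/50 : ℚ) := by
    refine Polynomial.funext fun y => ?_
    simp [Finset.Nat.antidiagonal_succ, expCoeff_zero, eval_expCoeff_one, eval_expCoeff_two]
    ring
  rw [degreeCoeff, h]
  simp only [momentFunctional_add, momentFunctional_monomial]
  norm_num [Nat.factorial]

lemma degreeCoeff_three : degreeCoeff 3 = -61479 / 3200 := by
  have h : ∑ p ∈ HasAntidiagonal.antidiagonal 3,
      monomial (p.1 + 1) ((-1 : ℚ) ^ p.1 * ((p.1 : ℚ) + 1)) * expCoeff p.2 =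
      monomial 3 (-1 : ℚ) + monomial 4 (-59/15 : ℚ) + monomial 5 (314/315 : ℚ) +
        monomial 6 (-12/175 : ℚ) + monomial 7 (1/750 : ℚ) := by
    refine Polynomial.funext fun y => ?_
    simp [Finset.Nat.antidiagonal_succ, expCoeff_zero, eval_expCoeff_one, eval_expCoeff_two,
      eval_expCoeff_three]
    ring
  rw [degreeCoeff, h]
  simp only [momentFunctional_add, momentFunctional_monomial]
  norm_num [Nat.factorial]

lemma degreeCoeff_four : degreeCoeff 4 = 25225773 / 358400 := by
  have h : ∑ p ∈ HasAntidiagonal.antidiagonal 4,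
      monomial (p.1 + 1) ((-1 : ℚ) ^ p.1 * ((p.1 : ℚ) + 1)) * expCoeff p.2 =
      monomial 3 (1/18 : ℚ) + monomial 4 (2 : ℚ) + monomial 5 (499/105 : ℚ) +
        monomial 6 (-53189/34650 : ℚ) + monomial 7 (1649/11025 : ℚ) +
        monomial 8 (-29/5250 : ℚ) + monomial 9 (1/15000 : ℚ) := by
    refine Polynomial.funext fun y => ?_
    simp [Finset.Nat.antidiagonal_succ, expCoeff_zero, eval_expCoeff_one, eval_expCoeff_two,
      eval_expCoeff_three, eval_expCoeff_four]
    ring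
  rw [degreeCoeff, h]
  simp only [momentFunctional_add, momentFunctional_monomial]
  norm_num [Nat.factorial]

lemma coeffC_values : coeffC 0 = 1 ∧ coeffC 1 = -9 / 8 ∧ coeffC 2 = -111 / 640 ∧
    coeffC 3 = -9999 / 25600 ∧ coeffC 4 = 87261 / 5734400 := by
  refine ⟨?_, ?_, ?_, ?_, ?_⟩ <;>
  norm_num [coeffC, sum_Icc_succ_top, degreeCoeff_zero, degreeCoeff_one, degreeCoeff_two,
    degreeCoeff_three, degreeCoeff_four, Nat.choose]

lemma coeffE_values : coeffE 0 = 0 ∧ coeffE 1 = 11 / 6 ∧ coeffE 2 = 141 / 160 ∧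
    coeffE 3 = 9973 / 28800 ∧ coeffE 4 = 59673 / 179200 := by
  obtain ⟨-, c1, c2, c3, c4⟩ := coeffC_values
  obtain ⟨s2, s3, s4, k3, k4, q4⟩ := coeff_pow_small
    (A := PowerSeries.mk fun j => if j = 0 then 0 else coeffC j) (by simp)
  have b3 : bernoulli 3 = 0 := bernoulli_eq_zero_of_odd (by decide) (by norm_num)
  have b4 : bernoulli 4 = -1 / 30 := by
    rw [bernoulli_eq_bernoulli'_of_ne_one (by norm_num), bernoulli'_four]
  have b5 : bernoulli 5 = 0 := bernoulli_eq_zero_of_odd (by decide) (by norm_num)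
  refine ⟨?_, ?_, ?_, ?_, ?_⟩ <;>
  norm_num [coeffE, logCoeff, sum_Icc_succ_top, s2, s3, s4, k3, k4, q4, PowerSeries.coeff_mk,
    c1, c2, c3, c4, b3, b4, b5, bernoulli_two]

/-- The expansion of the logarithm of the number of lines, from those of the normalized number of
lines, of `log (1 - 3 / (2 n))`, and the Stirling series. -/
lemma hasAsymptoticExpansion_log_lineCount : HasAsymptoticExpansion
    (fun n : ℕ => Real.log ((lineCount n : ℝ) / ((2 * n)! : ℝ)) -
      (2 * (n : ℝ) - 4 * Real.log (n : ℝ) +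
        (-3 - Real.log Real.pi - 3 / 2 * Real.log (8 / 3)))) coeffE := by
  have hF0 : PowerSeries.coeff 0
      (Scale.compSeries degreeCoeff (moebiusSeries (1 / 2) (3 / 2))) = 1 := by
    rw [coeff_compSeries_degreeCoeff, coeffC_values.1]
  obtain ⟨n₁, h4, hn₁⟩ := exists_abs_sub_one_le (hasExp_lineRatio le_rfl) hF0
  have hL := hasExp_log (hasExp_lineRatio h4) hF0 hn₁
  have hA := hasExp_mul_log_one_sub (n₀ := n₁) (by omega)
  have hR := hasExp_stirlingRemainder_two_mul (n₀ := n₁)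
  have hE := (((hL.add (hA.const_mul 2)).sub
    (((natScale_hasExp_eps n₁).mul hA).const_mul (7 / 2))).sub hR).add
    (natScale_hasExp_const n₁ 3)
  have hF1 : Scale.compSeries degreeCoeff (moebiusSeries (1 / 2) (3 / 2)) - 1 =
      PowerSeries.mk fun j => if j = 0 then 0 else coeffC j := by
    ext k
    rw [map_sub, coeff_compSeries_degreeCoeff, PowerSeries.coeff_mk, PowerSeries.coeff_one]
    split_ifs with h
    · rw [h, coeffC_values.1, sub_self]
    · rw [sub_zero]
  rw [hF1] at hL hE
  refine hasAsymptoticExpansion_of_hasExp (n₀ := n₁) (hE.congr fun n hn => ?_) fun k => ?_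
  · have hn4 : 4 ≤ n := h4.trans hn.1
    have hn0 : (4 : ℝ) ≤ n := by exact_mod_cast hn4
    have hv : (0 : ℝ) < lineCount n := by exact_mod_cast lineCount_pos (show 2 ≤ n by omega)
    have hD : 0 < 2 * (n : ℝ) - 3 := by linarith
    have hpi := Real.pi_pos
    have e1 : Real.log (lineRatio n) = Real.log (lineCount n) - (Real.log (27 / Real.pi) / 2 +
        (2 * (n : ℝ) - 7 / 2) * Real.log (2 * (n : ℝ) - 3)) := by
      rw [lineRatio, Real.log_div hv.ne' (by positivity),
        Real.log_mul (by positivity) (by positivity), Real.log_sqrt (by positivity),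
        Real.log_rpow hD]
    have e2 : Real.log (1 - 3 / (2 * (n : ℝ))) =
        Real.log (2 * (n : ℝ) - 3) - (Real.log 2 + Real.log n) := by
      rw [← Real.log_mul (by norm_num) (by linarith), ← Real.log_div hD.ne' (by positivity)]
      congr 1
      field_simp
    have e3 : stirlingRemainder (2 * n) = Real.log ((2 * n)! : ℝ) -
        ((2 * (n : ℝ) + 1 / 2) * (Real.log 2 + Real.log n) - 2 * n +
          (Real.log 2 + Real.log Real.pi) / 2) := by
      rw [stirlingRemainder]
      push_cast
      rw [Real.log_mul (by norm_num) (by linarith), Real.log_mul (by norm_num) hpi.ne']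
    have e4 : Real.log (27 / Real.pi) = 3 * Real.log 3 - Real.log Real.pi := by
      rw [Real.log_div (by norm_num) hpi.ne', show (27 : ℝ) = 3 ^ 3 by norm_num, Real.log_pow]
      norm_num
    have e5 : Real.log (8 / 3) = 3 * Real.log 2 - Real.log 3 := by
      rw [Real.log_div (by norm_num) (by norm_num), show (8 : ℝ) = 2 ^ 3 by norm_num, Real.log_pow]
      norm_num
    rw [e1, e2, e3, e4, e5, Real.log_div hv.ne' (by positivity)]
    push_cast
    field_simp
    ring
  · simp only [map_add, map_sub, PowerSeries.coeff_smul, PowerSeries.coeff_mk,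
      coeff_compSeries_log, PowerSeries.coeff_C]
    rw [coeffE]
    cases k with
    | zero =>
      norm_num [logCoeff, stirlingCoeff]
    | succ k =>
      rw [if_neg (Nat.succ_ne_zero k), if_neg (Nat.succ_ne_zero k), PowerSeries.coeff_succ_X_mul,
        PowerSeries.coeff_mk, stirlingCoeff, smul_eq_mul, smul_eq_mul]
      push_cast
      field_simp
      ring

end LinesInHypersurfaces

end

theorem mainTheorem3 :
    ∃ v : ℕ → ℤ,
      (∀ n : ℕ, 2 ≤ n → ∀ w : Fin (n + 1) → ℂ, Function.Injective w →
        LinesInHypersurfaces.localizationSum n w = (v n : ℂ)) ∧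
      (∀ n : ℕ, 2 ≤ n → 0 < v n) ∧
      LinesInHypersurfaces.HasAsymptoticExpansion
        (fun n : ℕ => (v n : ℝ) /
          (Real.sqrt (27 / Real.pi) * (2 * (n : ℝ) - 3) ^ (2 * (n : ℝ) - 7 / 2)))
        LinesInHypersurfaces.coeffC ∧
      LinesInHypersurfaces.HasAsymptoticExpansion
        (fun n : ℕ => Real.log ((v n : ℝ) / ((2 * n)! : ℝ)) -
          (2 * (n : ℝ) - 4 * Real.log (n : ℝ) +
            (-3 - Real.log Real.pi - 3 / 2 * Real.log (8 / 3))))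
        LinesInHypersurfaces.coeffE ∧
      (LinesInHypersurfaces.coeffC 0 = 1 ∧
        LinesInHypersurfaces.coeffC 1 = -9 / 8 ∧
        LinesInHypersurfaces.coeffC 2 = -111 / 640 ∧
        LinesInHypersurfaces.coeffC 3 = -9999 / 25600 ∧
        LinesInHypersurfaces.coeffC 4 = 87261 / 5734400) ∧
      (LinesInHypersurfaces.coeffE 0 = 0 ∧
        LinesInHypersurfaces.coeffE 1 = 11 / 6 ∧
        LinesInHypersurfaces.coeffE 2 = 141 / 160 ∧
        LinesInHypersurfaces.coeffE 3 = 9973 / 28800 ∧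
        LinesInHypersurfaces.coeffE 4 = 59673 / 179200) :=
  ⟨LinesInHypersurfaces.lineCount,
    fun _ hn _ hw => LinesInHypersurfaces.localizationSum_eq hn hw,
    fun _ hn => LinesInHypersurfaces.lineCount_pos hn,
    LinesInHypersurfaces.hasAsymptoticExpansion_of_hasExp
      (LinesInHypersurfaces.hasExp_lineRatio le_rfl)
      LinesInHypersurfaces.coeff_compSeries_degreeCoeff,
    LinesInHypersurfaces.hasAsymptoticExpansion_log_lineCount,
    LinesInHypersurfaces.coeffC_values, LinesInHypersurfaces.coeffE_values⟩
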